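/- For a matroid $M$ on a finite set $E$ let $P(M)\subset\mathbb R^E$ be its base polytope, the convex hull of the incidence vectors of its bases. A decomposition of $P(M)$ into $t$ pieces is a family $M_1,\dots,M_t$ of matroids on $E$ with $P(M)=\bigcup_{i=1}^t P(M_i)$ such that, for all $i\ne j$, the intersection $P(M_i)\cap P(M_j)$ is a face of both $P(M_i)$ and $P(M_j)$, and $P(M_i)\not\subseteq P(M_j)$. Two such decompositions $(M_i)$ and $(M_i')$ are equivalent if there is a permutation $\sigma$ of $\{1,\dots,t\}$ such that, for every $i$, the polytopes $P(M_i)$ and $P(M'_{\sigma(i)})$ are combinatorially equivalent (have isomorphic face lattices); otherwise they are different. Let $h_t(M)$ be the number of different decompositions (that is, of equivalence classes of decompositions) of $P(M)$ into $t$ pieces, and let $p_t(n)$ be the number of different decompositions $n=p_1+\dots+p_t$ of the integer $n$ with all $p_i\ge 2$, where the order of the summands is disregarded. Let $n,r,t\ge 2$ be integers with $n\ge r+t$ and $r\ge t$, and let $U_{n,r}$ be the uniform matroid of rank $r$ on $n$ elements. Then $$h_t(U_{n,r})\ \ge\ p_t(n).$$ -/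

import Mathlib

/-- The uniform matroid `U_{n,r}` on the ground set `Fin n`: a set is independent iff it has at most
`r` elements. For `r ≤ n` its bases are exactly the `r`-element subsets. -/
def uniformMatroid (n r : ℕ) : Matroid (Fin n) :=
  (IndepMatroid.ofFinite (E := (Set.univ : Set (Fin n))) Set.finite_univ (fun I => I.ncard ≤ r)
    (by simp)
    (fun _ J hJ hIJ => (Set.ncard_le_ncard hIJ J.toFinite).trans hJ)
    (fun I J _ hJ hIJ => by
      obtain ⟨e, heJ, heI⟩ := Set.exists_mem_notMem_of_ncard_lt_ncard hIJ
      refine ⟨e, heJ, heI, ?_⟩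
      have h := Set.ncard_insert_le e I
      omega)
    (fun _ _ => Set.subset_univ _)).matroid

namespace MatroidDecomposition

variable {α : Type*}

/-- The matroid base polytope: the convex hull in `ℝ^α` of the incidence vectors of the bases. -/
def basePolytope (M : Matroid α) : Set (α → ℝ) :=
  convexHull ℝ {x | ∃ B : Set α, M.IsBase B ∧ x = B.indicator (fun _ => (1 : ℝ))}

/-- The faces of a polytope `P`, ordered by inclusion: the empty set and the sets of maximizers over
`P` of a linear functional (the zero functional gives `P` itself). -/
abbrev FaceLattice (P : Set (α → ℝ)) : Type _ :=
  {F : Set (α → ℝ) // IsExposed ℝ P F}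

/-- Two polytopes are combinatorially equivalent if their face lattices are isomorphic. -/
def CombEquiv (P Q : Set (α → ℝ)) : Prop :=
  Nonempty (FaceLattice P ≃o FaceLattice Q)

/-- `P(M) = ⋃ i, P(N i)` is a matroid base polytope decomposition of `P(M)` into `t` pieces: any two
pieces meet in a common face, and no piece is contained in another one. -/
structure IsDecomposition (M : Matroid α) {t : ℕ} (N : Fin t → Matroid α) : Prop where
  ground_eq : ∀ i, (N i).E = M.E
  eq_iUnion : basePolytope M = ⋃ i, basePolytope (N i)
  face_left : ∀ i j, i ≠ j →
    IsExposed ℝ (basePolytope (N i)) (basePolytope (N i) ∩ basePolytope (N j))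
  face_right : ∀ i j, i ≠ j →
    IsExposed ℝ (basePolytope (N j)) (basePolytope (N i) ∩ basePolytope (N j))
  not_subset : ∀ i j, i ≠ j → ¬ basePolytope (N i) ⊆ basePolytope (N j)

/-- The decompositions of `P(M)` into `t` pieces. -/
abbrev Decomposition (M : Matroid α) (t : ℕ) : Type _ :=
  {N : Fin t → Matroid α // IsDecomposition M N}

/-- Two decompositions are equivalent if, up to a permutation of the indices, corresponding pieces
are combinatorially equivalent. They are different otherwise. -/
def decompositionSetoid (M : Matroid α) (t : ℕ) : Setoid (Decomposition M t) where
  r N N' := ∃ σ : Equiv.Perm (Fin t),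
    ∀ i, CombEquiv (basePolytope (N.1 i)) (basePolytope (N'.1 (σ i)))
  iseqv :=
    { refl := fun _ => ⟨Equiv.refl _, fun _ => ⟨OrderIso.refl _⟩⟩
      symm := by
        rintro N N' ⟨σ, h⟩
        refine ⟨σ.symm, fun i => ?_⟩
        obtain ⟨e⟩ := h (σ.symm i)
        rw [Equiv.apply_symm_apply] at e
        exact ⟨e.symm⟩
      trans := by
        rintro N N' N'' ⟨σ, h⟩ ⟨τ, k⟩
        refine ⟨σ.trans τ, fun i => ?_⟩
        obtain ⟨e⟩ := h i
        obtain ⟨f⟩ := k (σ i)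
        exact ⟨e.trans f⟩ }

/-- `h_t(M)`: the number of different (pairwise inequivalent) decompositions of `P(M)` into `t`
pieces. -/
noncomputable def numDecompositions (t : ℕ) (M : Matroid α) : ℕ :=
  Nat.card (Quotient (decompositionSetoid M t))

end MatroidDecomposition

/-- `p_t(n)`: the number of decompositions `n = p₁ + ⋯ + p_t` with all `p_i ≥ 2`, two of them being
different if they are not rearrangements of each other. -/
def numParts (t n : ℕ) : ℕ :=
  (Finset.univ.filter fun p : n.Partition => p.parts.card = t ∧ ∀ i ∈ p.parts, 2 ≤ i).card

/-! Reflecting the cube by `x ↦ 1 - x` turns decompositions of `P(M)` into decompositions of `P(M✶)`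
and preserves face lattices, so it suffices to treat `2 * r ≤ n`.

Breaks `1 = s 0 < ⋯ < s t = n + 1 - r` cut the hypersimplex into pieces: piece `i` requires the sum
of the first `s i` coordinates to be at most 1 and that of the first `s (i + 1)` to be at least 1.
Prefix sums grow with their length, so each point lies in a piece where they pass 1, and two pieces
meet where a prefix sum equals 1. The pieces are base polytopes because their extreme points are
integral (`extremePoint_segmentPolytope_integral`). A partition with sorted parts `l 0 ≤ l 1 ≤ ⋯`
gives the inner breaks `s (i + 1) = l i + i`, all at most `n / 2`.

Inequivalence is detected by vertex degrees, which the face lattice determines. In piece `i` a base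
has degree `r * (n - r)`, less `y = (r - 1) * (s i - 1)` if it meets the first `s i` elements, less
`x = n + 1 - r - s (i + 1)` if it has only one of the first `s (i + 1)`. The set of degrees
determines the unordered pair of `x` and `y` (`deficits_eq_of_combEquiv`). Over all pieces this
gives the multiset of the numbers `n + 1 - r - v` and `(r - 1) * (v - 1)`, with `v` running over the
inner breaks. Two break sequences with the same multiset have occurrence counts whose difference is
finitely supported and changes sign under `v ↦ n + 1 - r - (r - 1) * (v - 1)`; such a function
vanishes (`eq_zero_of_reflection`). -/

namespace MatroidDecomposition

/-! ### Vertex degrees as invariants of an ordered set -/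

section VertexDegrees

variable {L L' : Type*} [PartialOrder L] [PartialOrder L']

/-- The elements of an order that are minimal among those that are not the bottom element. -/
def IsVertex (a : L) : Prop := ¬ IsBot a ∧ ∀ b < a, IsBot b

/-- Two different vertices `a`, `b` that are the only vertices below some element. -/
def IsEdgePair (a b : L) : Prop :=
  a ≠ b ∧ IsVertex a ∧ IsVertex b ∧ ∃ c, a ≤ c ∧ b ≤ c ∧ ∀ z ≤ c, IsVertex z → z = a ∨ z = b

/-- The number of vertices joined to `a` by an edge. -/
noncomputable def vertexDegree (a : L) : ℕ := {b | IsEdgePair a b}.ncard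

variable (L) in
/-- The degrees of the vertices. -/
def degreeSet : Set ℕ := {d | ∃ a : L, IsVertex a ∧ vertexDegree a = d}

theorem isBot_orderIso (e : L ≃o L') (a : L) : IsBot (e a) ↔ IsBot a := by
  constructor
  · intro h b
    simpa using h (e b)
  · intro h b
    obtain ⟨c, rfl⟩ := e.surjective b
    exact e.monotone (h c)

theorem IsVertex.map {a : L} (h : IsVertex a) (e : L ≃o L') : IsVertex (e a) := by
  refine ⟨fun hb => h.1 ((isBot_orderIso e a).1 hb), fun b hb => ?_⟩
  rw [← isBot_orderIso e.symm]
  exact h.2 _ ((OrderIso.symm_apply_lt e).2 hb)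

theorem IsEdgePair.map {a b : L} (h : IsEdgePair a b) (e : L ≃o L') :
    IsEdgePair (e a) (e b) := by
  obtain ⟨hab, ha, hb, c, hac, hbc, hc⟩ := h
  refine ⟨e.injective.ne hab, ha.map e, hb.map e, e c, e.monotone hac, e.monotone hbc, ?_⟩
  intro z hz hzv
  have := hc (e.symm z) ((OrderIso.symm_apply_le e).2 hz) (hzv.map e.symm)
  simpa [OrderIso.symm_apply_eq] using this

theorem vertexDegree_orderIso (e : L ≃o L') (a : L) : vertexDegree (e a) = vertexDegree a := by
  have : {b | IsEdgePair (e a) b} = e '' {b | IsEdgePair a b} := by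
    ext b
    constructor
    · intro h
      exact ⟨e.symm b, by simpa using h.map e.symm, by simp⟩
    · rintro ⟨b, h, rfl⟩
      exact h.map e
  rw [vertexDegree, this, Set.ncard_image_of_injective _ e.injective, vertexDegree]

theorem degreeSet_subset_of_orderIso (e : L ≃o L') : degreeSet L ⊆ degreeSet L' := by
  rintro d ⟨a, ha, rfl⟩
  exact ⟨e a, ha.map e, vertexDegree_orderIso e a⟩

theorem degreeSet_eq_of_orderIso (e : L ≃o L') : degreeSet L = degreeSet L' :=
  (degreeSet_subset_of_orderIso e).antisymm (degreeSet_subset_of_orderIso e.symm)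

end VertexDegrees

/-! ### Symmetric exchange of bases -/

section BaseExchange

variable {α : Type*} {M : Matroid α} {B B' : Set α} {e : α}

/-- The element `f` comes from the fundamental circuit of `e` over `B'`. If the rest of that circuit
lay in the closure of `B \ {e}`, so would `e`, against independence of `B`. -/
theorem exists_symmetric_exchange (hB : M.IsBase B) (hB' : M.IsBase B') (he : e ∈ B \ B') :
    ∃ f ∈ B' \ B, M.IsBase (insert f (B \ {e})) ∧ M.IsBase (insert e (B' \ {f})) := by
  have heE : e ∈ M.E := hB.subset_ground he.1
  have hcl : e ∈ M.closure B' := by rwa [hB'.closure_eq]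
  have hC := hB'.indep.fundCircuit_isCircuit hcl he.2
  have heC : e ∈ M.fundCircuit e B' := M.mem_fundCircuit e B'
  have hex : ∃ f ∈ M.fundCircuit e B' \ {e}, f ∉ M.closure (B \ {e}) := by
    by_contra! hcon
    have h1 : M.closure (M.fundCircuit e B' \ {e}) ⊆ M.closure (B \ {e}) :=
      M.closure_subset_closure_of_subset_closure hcon
    exact hB.indep.notMem_closure_sdiff_of_mem he.1
      (h1 (hC.mem_closure_sdiff_singleton_of_mem heC))
  obtain ⟨f, ⟨hfC, hfe⟩, hf⟩ := hex
  have hfE : f ∈ M.E := hC.subset_ground hfC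
  have hfB' : f ∈ B' := by
    have := M.fundCircuit_subset_insert e B' hfC
    exact this.resolve_left hfe
  have hfB : f ∉ B := fun h =>
    hf (M.mem_closure_of_mem' ⟨h, hfe⟩ hfE)
  refine ⟨f, ⟨hfB', hfB⟩, hB.exchange_base_of_notMem_closure he.1 hf, ?_⟩
  rw [Set.insert_sdiff_singleton_comm (Ne.symm hfe)]
  exact hB'.exchange_isBase_of_indep' hfB' he.2 ((hB'.indep.mem_fundCircuit_iff hcl he.2).1 hfC)

end BaseExchange

/-! ### Vertices and edges of base polytopes -/

section Vertices

variable {α : Type*} {M : Matroid α} {B B' : Set α}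

/-- The incidence vector of a set. -/
noncomputable def incidence (B : Set α) : α → ℝ := B.indicator fun _ => 1

theorem incidence_of_mem {e : α} (h : e ∈ B) : incidence B e = 1 := by simp [incidence, h]

theorem incidence_of_notMem {e : α} (h : e ∉ B) : incidence B e = 0 := by simp [incidence, h]

theorem incidence_injective : Function.Injective (incidence : Set α → α → ℝ) := by
  intro B B' h
  ext e
  have := congrFun h e
  by_cases h1 : e ∈ B <;> by_cases h2 : e ∈ B' <;>
    simp_all [incidence_of_mem, incidence_of_notMem]

theorem incidence_mem_basePolytope (hB : M.IsBase B) : incidence B ∈ basePolytope M :=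
  subset_convexHull ℝ _ ⟨B, hB, rfl⟩

theorem basePolytope_subset_of_convex {K : Set (α → ℝ)} (hK : Convex ℝ K)
    (h : ∀ B, M.IsBase B → incidence B ∈ K) : basePolytope M ⊆ K := by
  refine convexHull_min ?_ hK
  rintro _ ⟨B, hB, rfl⟩
  exact h B hB

theorem basePolytope_subset_Icc : basePolytope M ⊆ Set.Icc 0 1 := by
  refine basePolytope_subset_of_convex (convex_Icc _ _) fun B _ => ⟨fun e => ?_, fun e => ?_⟩ <;>
    by_cases h : e ∈ B <;> simp [incidence, h]

theorem exists_base_functional_ge (l : StrongDual ℝ (α → ℝ)) {x : α → ℝ}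
    (hx : x ∈ basePolytope M) : ∃ B, M.IsBase B ∧ l x ≤ l (incidence B) := by
  obtain ⟨_, ⟨B, hB, rfl⟩, h⟩ := (l.toLinearMap.convexOn convex_univ).exists_ge_of_mem_convexHull
    (Set.subset_univ _) hx
  exact ⟨B, hB, h⟩

theorem exists_incidence_mem_face {F : Set (α → ℝ)} (hF : IsExposed ℝ (basePolytope M) F)
    (hne : F.Nonempty) : ∃ B, M.IsBase B ∧ incidence B ∈ F := by
  obtain ⟨l, rfl⟩ := hF hne
  obtain ⟨x, hx, hmax⟩ := hne
  obtain ⟨B, hB, h⟩ := exists_base_functional_ge l hx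
  exact ⟨B, hB, incidence_mem_basePolytope hB, fun y hy => (hmax y hy).trans h⟩

theorem isBot_face_iff (F : FaceLattice (basePolytope M)) : IsBot F ↔ F.1 = ∅ := by
  constructor
  · intro h
    have := h ⟨∅, fun h => absurd h (by simp)⟩
    exact Set.subset_empty_iff.1 this
  · intro h G
    rw [← Subtype.coe_le_coe, h]
    exact Set.empty_subset _

variable [Fintype α]

/-- The linear functional with given coefficients. -/
noncomputable def weightFunctional (w : α → ℝ) : StrongDual ℝ (α → ℝ) :=
  ∑ i, w i • ContinuousLinearMap.proj i

theorem weightFunctional_apply (w x : α → ℝ) : weightFunctional w x = ∑ i, w i * x i := by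
  simp [weightFunctional]

/-- A sum of separately bounded terms attains its bound exactly when every term does. -/
theorem isExposed_of_coordinatewise_max {P : Set (α → ℝ)} {w u : α → ℝ} (hu : u ∈ P)
    (hmax : ∀ x ∈ P, ∀ i, w i * x i ≤ w i * u i) :
    IsExposed ℝ P {x | x ∈ P ∧ ∀ i, w i * x i = w i * u i} := by
  intro _
  refine ⟨weightFunctional w, ?_⟩
  ext x
  refine and_congr_right fun hx => ?_
  simp only [weightFunctional_apply]
  constructor
  · intro h y hy
    exact (Finset.sum_le_sum fun i _ => hmax y hy i).trans_eq
      (Finset.sum_congr rfl fun i _ => (h i).symm)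
  · intro h i
    have h1 := (h u hu).antisymm' (Finset.sum_le_sum fun i _ => hmax x hx i)
    exact (Finset.sum_eq_sum_iff_of_le fun i _ => hmax x hx i).1 h1 i (Finset.mem_univ i)

theorem isExposed_singleton_incidence (hB : M.IsBase B) :
    IsExposed ℝ (basePolytope M) {incidence B} := by
  -- The weights are `1` on `B` and `-1` off it, so `incidence B` is the only maximizer even over
  -- the cube.
  have h := isExposed_of_coordinatewise_max (P := basePolytope M)
    (w := fun i => 2 * incidence B i - 1) (incidence_mem_basePolytope hB) (by
      intro x hx i
      have h0 := (basePolytope_subset_Icc hx).1 i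
      have h1 := (basePolytope_subset_Icc hx).2 i
      simp only [Pi.zero_apply, Pi.one_apply] at h0 h1
      by_cases h : i ∈ B
      · simp only [incidence_of_mem h]; linarith
      · simp only [incidence_of_notMem h]; linarith)
  convert h using 1
  ext x
  constructor
  · rintro rfl
    exact ⟨incidence_mem_basePolytope hB, fun _ => rfl⟩
  · rintro ⟨-, h⟩
    ext i
    have := h i
    by_cases h : i ∈ B
    · simp only [incidence_of_mem h] at *; linarith
    · simp only [incidence_of_notMem h] at *; linarith

/-- The vertex of the base polytope given by a base. -/
noncomputable def baseVertex (hB : M.IsBase B) : FaceLattice (basePolytope M) :=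
  ⟨{incidence B}, isExposed_singleton_incidence hB⟩

theorem baseVertex_le_iff (hB : M.IsBase B) (F : FaceLattice (basePolytope M)) :
    baseVertex hB ≤ F ↔ incidence B ∈ F.1 := by
  rw [← Subtype.coe_le_coe, baseVertex]
  exact Set.singleton_subset_iff

theorem baseVertex_inj (hB : M.IsBase B) (hB' : M.IsBase B') :
    baseVertex hB = baseVertex hB' ↔ B = B' := by
  rw [baseVertex, baseVertex, Subtype.mk_eq_mk, Set.singleton_eq_singleton_iff,
    incidence_injective.eq_iff]

theorem isVertex_face_iff (F : FaceLattice (basePolytope M)) :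
    IsVertex F ↔ ∃ (B : Set α) (hB : M.IsBase B), F = baseVertex hB := by
  constructor
  · rintro ⟨h1, h2⟩
    rw [isBot_face_iff, ← ne_eq, ← Set.nonempty_iff_ne_empty] at h1
    obtain ⟨B, hB, hF⟩ := exists_incidence_mem_face F.2 h1
    refine ⟨B, hB, ?_⟩
    rw [← baseVertex_le_iff hB] at hF
    by_contra hne
    have := (isBot_face_iff _).1 (h2 _ (lt_of_le_of_ne hF (Ne.symm hne)))
    simp [baseVertex] at this
  · rintro ⟨B, hB, rfl⟩
    refine ⟨by simp [isBot_face_iff, baseVertex], fun G hG => ?_⟩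
    rw [isBot_face_iff]
    exact Set.ssubset_singleton_iff.1 (Subtype.coe_lt_coe.2 hG)

theorem isEdgePair_of_ncard_sdiff_eq_one (hB : M.IsBase B) (hB' : M.IsBase B')
    (h : (B \ B').ncard = 1) : IsEdgePair (baseVertex hB) (baseVertex hB') := by
  obtain ⟨e, he⟩ := Set.ncard_eq_one.1 h
  obtain ⟨f, hf⟩ := Set.ncard_eq_one.1 ((hB.ncard_sdiff_comm hB').symm.trans h)
  have he' : e ∈ B \ B' := by rw [he]; rfl
  have hne : B ≠ B' := by rintro rfl; exact he'.2 he'.1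
  have hBB : ∀ i ∈ B, i ∉ B' → i = e := fun i h1 h2 => by
    have : i ∈ B \ B' := ⟨h1, h2⟩
    rwa [he] at this
  have hBB' : ∀ i ∈ B', i ∉ B → i = f := fun i h1 h2 => by
    have : i ∈ B' \ B := ⟨h1, h2⟩
    rwa [hf] at this
  -- The weights are `1` on `B ∩ B'`, `-1` off `B ∪ B'` and `0` at `e` and `f`, so the vertices of
  -- this face are the bases between `B ∩ B'` and `B ∪ B'`.
  have hexp := isExposed_of_coordinatewise_max (P := basePolytope M)
    (w := fun i => incidence B i + incidence B' i - 1) (incidence_mem_basePolytope hB) (by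
      intro x hx i
      have h0 := (basePolytope_subset_Icc hx).1 i
      have h1 := (basePolytope_subset_Icc hx).2 i
      simp only [Pi.zero_apply, Pi.one_apply] at h0 h1
      by_cases h : i ∈ B <;> by_cases h' : i ∈ B' <;>
        simp [incidence_of_mem, incidence_of_notMem, h, h', h0, h1])
  refine ⟨by simpa [baseVertex_inj] using hne, (isVertex_face_iff _).2 ⟨B, hB, rfl⟩,
    (isVertex_face_iff _).2 ⟨B', hB', rfl⟩, ⟨_, hexp⟩, ?_, ?_, ?_⟩
  · rw [baseVertex_le_iff]
    exact ⟨incidence_mem_basePolytope hB, fun _ => rfl⟩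
  · rw [baseVertex_le_iff]
    refine ⟨incidence_mem_basePolytope hB', fun i => ?_⟩
    by_cases h : i ∈ B <;> by_cases h' : i ∈ B' <;>
        simp [incidence_of_mem, incidence_of_notMem, h, h']
  · intro z hz hzv
    obtain ⟨C, hC, rfl⟩ := (isVertex_face_iff _).1 hzv
    rw [baseVertex_le_iff] at hz
    have hz := hz.2
    have hsub : ∀ i ∈ C, i ∉ B → i ∈ B' := by
      intro i h1 h2
      by_contra h3
      have := hz i
      simp [incidence_of_mem, incidence_of_notMem, h1, h2, h3] at this
    have hsup : ∀ i ∈ B, i ∈ B' → i ∈ C := by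
      intro i h1 h2
      by_contra h3
      have := hz i
      simp [incidence_of_mem, incidence_of_notMem, h1, h2, h3] at this
    rw [baseVertex_inj, baseVertex_inj]
    by_cases heC : e ∈ C
    · left
      refine (hB.eq_of_subset_isBase hC fun i hi => ?_).symm
      by_cases hi' : i ∈ B'
      · exact hsup i hi hi'
      · rwa [hBB i hi hi']
    · right
      refine hC.eq_of_subset_isBase hB' fun i hi => ?_
      by_contra hi'
      by_cases hiB : i ∈ B
      · exact heC (hBB i hiB hi' ▸ hi)
      · exact hi' (hsub i hi hiB)

/-- Symmetric exchange gives bases whose incidence vectors have the same sum as those of `B` and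
`B'`. A face containing `B` and `B'` then contains the new bases; on an edge this forces the
exchange of one element to lead from `B` to `B'`. -/
theorem ncard_sdiff_eq_one_of_isEdgePair (hB : M.IsBase B) (hB' : M.IsBase B')
    (h : IsEdgePair (baseVertex hB) (baseVertex hB')) : (B \ B').ncard = 1 := by
  obtain ⟨hne, -, -, F, hF, hF', hF''⟩ := h
  rw [ne_eq, baseVertex_inj] at hne
  rw [baseVertex_le_iff] at hF hF'
  obtain ⟨e, he⟩ : (B \ B').Nonempty := by
    rw [Set.nonempty_iff_ne_empty, ne_eq, Set.sdiff_eq_empty]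
    exact fun h => hne (hB.eq_of_subset_isBase hB' h)
  obtain ⟨f, hf, hC, hC'⟩ := exists_symmetric_exchange hB hB' he
  have hef : e ≠ f := fun h => hf.2 (h ▸ he.1)
  have hsum : incidence (insert f (B \ {e})) + incidence (insert e (B' \ {f})) =
      incidence B + incidence B' := by
    classical
    ext i
    simp only [incidence, Pi.add_apply, Set.indicator, Set.mem_insert_iff, Set.mem_sdiff,
      Set.mem_singleton_iff]
    by_cases hie : i = e
    · subst hie
      simp [he.1, he.2, hef]
    · by_cases hif : i = f
      · subst hif
        simp [hf.1, hf.2, Ne.symm hef]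
      · simp [hie, hif]
  obtain ⟨F, hexp⟩ := F
  simp only at hF hF'
  have hCF : incidence (insert f (B \ {e})) ∈ F := by
    obtain ⟨l, hl⟩ := hexp ⟨_, hF⟩
    rw [hl] at hF hF' ⊢
    refine ⟨incidence_mem_basePolytope hC, fun y hy => ?_⟩
    have h1 := congrArg l hsum
    rw [map_add, map_add] at h1
    have h2 := hF.2 _ (incidence_mem_basePolytope hC')
    have h3 := hF'.2 _ hy
    linarith
  have := hF'' (baseVertex hC) ((baseVertex_le_iff _ _).2 hCF) ((isVertex_face_iff _).2 ⟨_, hC, rfl⟩)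
  rw [baseVertex_inj, baseVertex_inj] at this
  obtain h | h := this
  · exact absurd (h ▸ Set.mem_insert f _) hf.2
  · rw [Set.ncard_eq_one]
    refine ⟨e, Set.eq_singleton_iff_unique_mem.2 ⟨he, fun i hi => ?_⟩⟩
    by_contra hie
    exact hi.2 (h ▸ Set.mem_insert_of_mem f ⟨hi.1, hie⟩)

/-- The number of bases that differ from `B` by the exchange of one element. -/
noncomputable def baseDegree (M : Matroid α) (B : Set α) : ℕ :=
  {B' | M.IsBase B' ∧ (B \ B').ncard = 1}.ncard

theorem vertexDegree_baseVertex (hB : M.IsBase B) :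
    vertexDegree (baseVertex hB) = baseDegree M B := by
  have hinj : Function.Injective fun C : Set α => ({incidence C} : Set (α → ℝ)) :=
    Set.singleton_injective.comp incidence_injective
  rw [vertexDegree, baseDegree, ← Set.ncard_image_of_injective _ Subtype.val_injective,
    ← Set.ncard_image_of_injective _ hinj]
  congr 1
  ext X
  constructor
  · rintro ⟨F, hF, rfl⟩
    obtain ⟨C, hC, rfl⟩ := (isVertex_face_iff _).1 hF.2.2.1
    exact ⟨C, ⟨hC, ncard_sdiff_eq_one_of_isEdgePair hB hC hF⟩, rfl⟩
  · rintro ⟨C, ⟨hC, h⟩, rfl⟩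
    exact ⟨baseVertex hC, isEdgePair_of_ncard_sdiff_eq_one hB hC h, rfl⟩

theorem degreeSet_faceLattice (M : Matroid α) :
    degreeSet (FaceLattice (basePolytope M)) = {d | ∃ B, M.IsBase B ∧ baseDegree M B = d} := by
  ext d
  constructor
  · rintro ⟨F, hF, rfl⟩
    obtain ⟨B, hB, rfl⟩ := (isVertex_face_iff _).1 hF
    exact ⟨B, hB, (vertexDegree_baseVertex hB).symm⟩
  · rintro ⟨B, hB, rfl⟩
    exact ⟨baseVertex hB, (isVertex_face_iff _).2 ⟨B, hB, rfl⟩, vertexDegree_baseVertex hB⟩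

theorem CombEquiv.baseDegrees_eq {M N : Matroid α}
    (h : CombEquiv (basePolytope M) (basePolytope N)) :
    {d | ∃ B, M.IsBase B ∧ baseDegree M B = d} = {d | ∃ B, N.IsBase B ∧ baseDegree N B = d} := by
  obtain ⟨e⟩ := h
  rw [← degreeSet_faceLattice, ← degreeSet_faceLattice, degreeSet_eq_of_orderIso e]

end Vertices

/-! ### The matroids cut out by two initial segments -/

section SegmentMatroid

/-- The first `k` elements of `Fin n`. -/
def initSeg (n k : ℕ) : Set (Fin n) := {e | (e : ℕ) < k}

theorem mem_initSeg {n k : ℕ} {e : Fin n} : e ∈ initSeg n k ↔ (e : ℕ) < k := Iff.rfl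

theorem initSeg_mono (n : ℕ) {k l : ℕ} (h : k ≤ l) : initSeg n k ⊆ initSeg n l :=
  fun _ he => lt_of_lt_of_le he h

theorem initSeg_self (n : ℕ) : initSeg n n = Set.univ :=
  Set.eq_univ_of_forall fun e => e.2

theorem ncard_initSeg {n k : ℕ} (h : k ≤ n) : (initSeg n k).ncard = k := by
  have : Fin.val '' initSeg n k = ↑(Finset.range k) := by
    ext i
    simp only [Set.mem_image, mem_initSeg, Finset.coe_range, Set.mem_Iio]
    exact ⟨by rintro ⟨e, he, rfl⟩; exact he, fun hi => ⟨⟨i, by omega⟩, hi, rfl⟩⟩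
  rw [← Set.ncard_image_of_injective _ Fin.val_injective, this, Set.ncard_coe_finset,
    Finset.card_range]

theorem ncard_compl_initSeg {n k : ℕ} (h : k ≤ n) : (initSeg n k)ᶜ.ncard = n - k := by
  rw [Set.ncard_compl, ncard_initSeg h, Nat.card_eq_fintype_card, Fintype.card_fin]

/-- The `r`-sets with at most one element among the first `s` elements and at least one among the
first `u` elements. -/
structure IsSegmentBase (n r s u : ℕ) (B : Set (Fin n)) : Prop where
  ncard_eq : B.ncard = r
  subsingleton : (B ∩ initSeg n s).Subsingleton
  nonempty : (B ∩ initSeg n u).Nonempty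

variable {n r s u : ℕ}

/-- Any `f` works if `B \ {e}` meets the larger segment and misses the smaller. If it misses the
larger, `f` is taken from `B'` inside it. If it meets the smaller in `a`, some `f` lies outside the
smaller: otherwise `B' \ B` would be a singleton, while `a` and `e` would both lie in `B \ B'`. -/
theorem IsSegmentBase.exchange (h : s ≤ u) : Matroid.ExchangeProperty (IsSegmentBase n r s u) := by
  intro B B' hB hB' e he
  have key : ∀ f ∈ B' \ B, (f ∈ initSeg n s → B \ {e} ∩ initSeg n s = ∅) →
      (f ∈ initSeg n u ∨ (B \ {e} ∩ initSeg n u).Nonempty) →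
      ∃ f ∈ B' \ B, IsSegmentBase n r s u (insert f (B \ {e})) := by
    intro f hf h1 h2
    refine ⟨f, hf, ⟨?_, ?_, ?_⟩⟩
    · rw [Set.ncard_exchange hf.2 he.1, hB.ncard_eq]
    · by_cases hfs : f ∈ initSeg n s
      · rw [Set.insert_inter_of_mem hfs, h1 hfs]
        simp
      · rw [Set.insert_inter_of_notMem hfs]
        exact hB.subsingleton.anti (Set.inter_subset_inter_left _ Set.sdiff_subset)
    · obtain h2 | ⟨a, ha⟩ := h2
      · exact ⟨f, Set.mem_insert _ _, h2⟩
      · exact ⟨a, Set.mem_insert_of_mem _ ha.1, ha.2⟩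
  have hcard : (B' \ B).ncard = (B \ B').ncard := by
    have h1 := Set.ncard_sdiff_add_ncard B B'
    have h2 := Set.ncard_sdiff_add_ncard B' B
    rw [Set.union_comm, hB.ncard_eq] at h2
    rw [hB'.ncard_eq] at h1
    omega
  have hpos : 0 < (B \ B').ncard := (Set.ncard_pos).2 ⟨e, he⟩
  by_cases hu : (B \ {e} ∩ initSeg n u).Nonempty
  · by_cases hs : B \ {e} ∩ initSeg n s = ∅
    · obtain ⟨f, hf⟩ : (B' \ B).Nonempty := (Set.ncard_pos).1 (hcard ▸ hpos)
      exact key f hf (fun _ => hs) (Or.inr hu)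
    · obtain ⟨a, ⟨haB, hae⟩, has⟩ := Set.nonempty_iff_ne_empty.2 hs
      by_cases hex : ∃ f ∈ B' \ B, f ∉ initSeg n s
      · obtain ⟨f, hf, hfs⟩ := hex
        exact key f hf (fun h => absurd h hfs) (Or.inr hu)
      · push Not at hex
        exfalso
        have hone : (B' \ B).ncard ≤ 1 := by
          rw [Set.ncard_le_one]
          intro f hf g hg
          exact hB'.subsingleton ⟨hf.1, hex f hf⟩ ⟨hg.1, hex g hg⟩
        obtain ⟨f, hf⟩ : (B' \ B).Nonempty := (Set.ncard_pos).1 (hcard ▸ hpos)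
        have haB' : a ∉ B' := fun h =>
          hf.2 (hB'.subsingleton ⟨hf.1, hex f hf⟩ ⟨h, has⟩ ▸ haB)
        rw [hcard, Set.ncard_le_one] at hone
        exact hae (hone a ⟨haB, haB'⟩ e he)
  · obtain ⟨f, hfB', hfu⟩ := hB'.nonempty
    rw [Set.not_nonempty_iff_eq_empty] at hu
    have hfB : f ∉ B := by
      intro hfB
      have hfe : f ≠ e := by rintro rfl; exact he.2 hfB'
      have : f ∈ B \ {e} ∩ initSeg n u := ⟨⟨hfB, hfe⟩, hfu⟩
      rw [hu] at this
      exact this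
    refine key f ⟨hfB', hfB⟩ (fun _ => ?_) (Or.inl hfu)
    exact Set.subset_empty_iff.1 (hu ▸ Set.inter_subset_inter_right _ (initSeg_mono n h))

/-- Here and in the next two lemmas the final block avoids the first `u` elements, so only the
inserted elements matter. These bases witness the non-containment of pieces and the three possible
nontrivial degree losses. -/
theorem isSegmentBase_insert_compl (hr : 1 ≤ r) (hsu : s < u) (hu : u + r ≤ n + 1) (k : Fin n)
    (hk : s ≤ k) (hk' : (k : ℕ) < u) :
    IsSegmentBase n r s u (insert k (initSeg n (n + 1 - r))ᶜ) := by
  refine ⟨?_, ?_, ⟨k, Set.mem_insert _ _, hk'⟩⟩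
  · rw [Set.ncard_insert_of_notMem (by simp [mem_initSeg]; omega), ncard_compl_initSeg (by omega)]
    omega
  · rintro a ⟨ha | ha, has⟩
    · rw [mem_initSeg] at has
      omega
    · rw [Set.mem_compl_iff, mem_initSeg] at ha
      rw [mem_initSeg] at has
      omega

theorem isSegmentBase_zero_insert_compl (hr : 1 ≤ r) (hs : 1 ≤ s) (hsu : s < u)
    (hu : u + r ≤ n + 1) (k : Fin n) (hk : (k : ℕ) = 0) :
    IsSegmentBase n r s u (insert k (initSeg n (n + 1 - r))ᶜ) := by
  refine ⟨?_, ?_, ⟨k, Set.mem_insert _ _, by rw [mem_initSeg]; omega⟩⟩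
  · rw [Set.ncard_insert_of_notMem (by simp [mem_initSeg]; omega), ncard_compl_initSeg (by omega)]
    omega
  · refine (Set.subsingleton_singleton (a := k)).anti ?_
    rintro a ⟨ha | ha, has⟩
    · exact ha
    · rw [Set.mem_compl_iff, mem_initSeg] at ha
      rw [mem_initSeg] at has
      omega

theorem isSegmentBase_pair_insert_compl (hr : 2 ≤ r) (hs : 1 ≤ s) (hsu : s < u)
    (hu : u + r ≤ n + 1) (k l : Fin n) (hk : (k : ℕ) = 0) (hl : (l : ℕ) = s) :
    IsSegmentBase n r s u (insert k (insert l (initSeg n (n + 2 - r))ᶜ)) := by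
  refine ⟨?_, ?_, ⟨k, Set.mem_insert _ _, by rw [mem_initSeg]; omega⟩⟩
  · rw [Set.ncard_insert_of_notMem (by simp [mem_initSeg, Fin.ext_iff]; omega),
      Set.ncard_insert_of_notMem (by simp [mem_initSeg]; omega),
      ncard_compl_initSeg (by omega)]
    omega
  · refine (Set.subsingleton_singleton (a := k)).anti ?_
    rintro a ⟨ha | ha | ha, has⟩
    · exact ha
    · rw [mem_initSeg] at has
      omega
    · rw [Set.mem_compl_iff, mem_initSeg] at ha
      rw [mem_initSeg] at has
      omega

/-- The matroid on `Fin n` whose bases are the `r`-sets with at most one element among the first `s`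
elements and at least one among the first `u` elements. -/
def segmentMatroid (hr : 1 ≤ r) (hsu : s < u) (hu : u + r ≤ n + 1) : Matroid (Fin n) :=
  Matroid.ofIsBaseOfFinite Set.finite_univ (IsSegmentBase n r s u)
    ⟨_, isSegmentBase_insert_compl hr hsu hu ⟨s, by omega⟩ le_rfl hsu⟩
    (IsSegmentBase.exchange hsu.le) fun _ _ => Set.subset_univ _

theorem segmentMatroid_isBase_iff {hr : 1 ≤ r} {hsu : s < u} {hu : u + r ≤ n + 1}
    {B : Set (Fin n)} : (segmentMatroid hr hsu hu).IsBase B ↔ IsSegmentBase n r s u B := Iff.rfl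

theorem uniformMatroid_indep_iff {I : Set (Fin n)} :
    (uniformMatroid n r).Indep I ↔ I.ncard ≤ r := by
  simp [uniformMatroid]

theorem uniformMatroid_ground : (uniformMatroid n r).E = Set.univ := rfl

theorem uniformMatroid_isBase_iff (h : r ≤ n) {B : Set (Fin n)} :
    (uniformMatroid n r).IsBase B ↔ B.ncard = r := by
  rw [Matroid.isBase_iff_maximal_indep, maximal_iff]
  simp only [uniformMatroid_indep_iff]
  constructor
  · rintro ⟨h1, h2⟩
    refine h1.antisymm ?_
    by_contra! hlt
    obtain ⟨e, -, he⟩ := Set.exists_mem_notMem_of_ncard_lt_ncard (s := B)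
      (t := Set.univ) (by rw [Set.ncard_univ, Nat.card_eq_fintype_card, Fintype.card_fin]; omega)
    have := Set.ncard_insert_of_notMem he
    exact he (h2 (by omega) (Set.subset_insert e B) ▸ Set.mem_insert e B)
  · rintro rfl
    exact ⟨le_rfl, fun C hC hBC => Set.eq_of_subset_of_ncard_le hBC hC⟩

/-- One element cannot be met twice, and only `r - 1` elements lie outside the first `n + 1 - r`, so
both conditions are void. -/
theorem uniformMatroid_eq_segmentMatroid (hr : 1 ≤ r) (hrn : r + 1 ≤ n) :
    uniformMatroid n r = segmentMatroid (s := 1) (u := n + 1 - r) hr (by omega) (by omega) := by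
  refine Matroid.ext_isBase rfl fun B _ => ?_
  rw [uniformMatroid_isBase_iff (by omega), segmentMatroid_isBase_iff]
  refine ⟨fun h => ⟨h, ?_, ?_⟩, fun h => h.ncard_eq⟩
  · rintro a ⟨-, ha⟩ b ⟨-, hb⟩
    rw [mem_initSeg] at ha hb
    omega
  · by_contra hcon
    have : B ⊆ (initSeg n (n + 1 - r))ᶜ := fun e he he' => hcon ⟨e, he, he'⟩
    have := Set.ncard_le_ncard this
    rw [ncard_compl_initSeg (by omega)] at this
    omega

end SegmentMatroid

/-! ### Inequality description of the base polytope -/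

section SegmentPolytope

open Filter Topology

variable {n r s u : ℕ}

theorem weightFunctional_single {α : Type*} [Fintype α] [DecidableEq α] (w : α → ℝ) (i : α) :
    weightFunctional w (Pi.single i 1) = w i := by
  simp [weightFunctional_apply, Pi.single_apply]

/-- The sum of the first `k` coordinates. -/
noncomputable def segSum (n k : ℕ) : StrongDual ℝ (Fin n → ℝ) :=
  weightFunctional (incidence (initSeg n k))

theorem segSum_eq_sum (k : ℕ) (x : Fin n → ℝ) :
    segSum n k x = ∑ i : Fin n with i.val < k, x i := by
  rw [segSum, weightFunctional_apply, Finset.sum_filter]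
  refine Finset.sum_congr rfl fun i _ => ?_
  by_cases h : (i : ℕ) < k
  · rw [incidence_of_mem (mem_initSeg.2 h), if_pos h, one_mul]
  · rw [incidence_of_notMem (fun h' => h (mem_initSeg.1 h')), if_neg h, zero_mul]

theorem segSum_mono {x : Fin n → ℝ} (hx : x ∈ Set.Icc 0 1) {k l : ℕ} (h : k ≤ l) :
    segSum n k x ≤ segSum n l x := by
  rw [segSum_eq_sum, segSum_eq_sum]
  refine Finset.sum_le_sum_of_subset_of_nonneg (fun i => ?_) fun i _ _ => hx.1 i
  simp only [Finset.mem_filter, Finset.mem_univ, true_and]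
  exact fun hi => hi.trans_le h

theorem segSum_incidence (k : ℕ) (B : Set (Fin n)) :
    segSum n k (incidence B) = (B ∩ initSeg n k).ncard := by
  classical
  have h : ∀ i : Fin n, (if i.val < k then incidence B i else 0) =
      if i ∈ B ∩ initSeg n k then 1 else 0 := by
    intro i
    by_cases h1 : i.val < k <;> by_cases h2 : i ∈ B <;>
      simp [h1, h2, mem_initSeg, incidence_of_mem, incidence_of_notMem]
  rw [segSum_eq_sum, Finset.sum_filter, Finset.sum_congr rfl fun i _ => h i, Finset.sum_boole,
    Set.ncard_eq_toFinset_card']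
  congr 2
  ext i
  simp

/-- The points of the hypersimplex whose first `s` coordinates sum up to at most one and whose
first `u` coordinates sum up to at least one. -/
def segmentPolytope (n r s u : ℕ) : Set (Fin n → ℝ) :=
  {x | x ∈ Set.Icc 0 1 ∧ segSum n n x = r ∧ segSum n s x ≤ 1 ∧ 1 ≤ segSum n u x}

theorem convex_segmentPolytope : Convex ℝ (segmentPolytope n r s u) := by
  refine (convex_Icc _ _).inter (Convex.inter ?_ (Convex.inter ?_ ?_))
  · exact convex_hyperplane (segSum n n).toLinearMap.isLinear _
  · exact convex_halfSpace_le (segSum n s).toLinearMap.isLinear _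
  · exact convex_halfSpace_ge (segSum n u).toLinearMap.isLinear _

theorem isCompact_segmentPolytope : IsCompact (segmentPolytope n r s u) := by
  refine isCompact_Icc.inter_right (IsClosed.inter ?_ (IsClosed.inter ?_ ?_))
  · exact isClosed_eq (segSum n n).continuous continuous_const
  · exact isClosed_le (segSum n s).continuous continuous_const
  · exact isClosed_le continuous_const (segSum n u).continuous

theorem incidence_mem_Icc {α : Type*} (B : Set α) : incidence B ∈ Set.Icc 0 1 := by
  constructor <;> intro i <;> by_cases h : i ∈ B <;> simp [incidence, h]

theorem incidence_mem_segmentPolytope_iff {B : Set (Fin n)} :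
    incidence B ∈ segmentPolytope n r s u ↔ IsSegmentBase n r s u B := by
  simp only [segmentPolytope, Set.mem_ofPred_eq, incidence_mem_Icc, true_and, segSum_incidence,
    initSeg_self, Set.inter_univ, Nat.cast_inj, Nat.cast_le_one, Nat.one_le_cast]
  constructor
  · rintro ⟨h1, h2, h3⟩
    exact ⟨h1, fun a ha b hb => (Set.ncard_le_one).1 h2 a ha b hb, (Set.ncard_pos).1 h3⟩
  · rintro ⟨h1, h2, h3⟩
    exact ⟨h1, (Set.ncard_le_one).2 fun a ha b hb => h2 ha hb, (Set.ncard_pos).2 h3⟩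

theorem eventually_add_mul_le {a b c : ℝ} (hac : a ≤ c) (h : b = 0 ∨ a ≠ c) :
    ∀ᶠ ε in 𝓝 (0 : ℝ), a + ε * b ≤ c := by
  obtain rfl | h := h
  · simpa using hac
  · have : Tendsto (fun ε : ℝ => a + ε * b) (𝓝 0) (𝓝 (a + 0 * b)) :=
      (Continuous.tendsto (by fun_prop) 0)
    rw [zero_mul, add_zero] at this
    exact (this.eventually_lt_const (lt_of_le_of_ne hac h)).mono fun _ => le_of_lt

theorem eventually_le_add_mul {a b c : ℝ} (hac : c ≤ a) (h : b = 0 ∨ a ≠ c) :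
    ∀ᶠ ε in 𝓝 (0 : ℝ), c ≤ a + ε * b := by
  have := eventually_add_mul_le (a := -a) (b := -b) (c := -c) (by linarith) (by simpa using h)
  exact this.mono fun ε hε => by linarith

theorem exists_int_sum_eq {ι : Type*} [DecidableEq ι] (A : Finset ι) (x : ι → ℝ) {i : ι}
    (hi : i ∈ A) (h : ∀ l ∈ A, l ≠ i → x l = 0 ∨ x l = 1) : ∃ m : ℤ, ∑ l ∈ A, x l = m + x i := by
  refine ⟨∑ l ∈ A.erase i, if x l = 0 then 0 else 1, ?_⟩
  rw [← Finset.sum_erase_add _ _ hi]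
  congr 1
  push_cast
  refine Finset.sum_congr rfl fun l hl => ?_
  rw [Finset.mem_erase] at hl
  obtain h | h := h l hl.2 hl.1 <;> simp [h]

/-- If `i < j` are the two smallest fractional coordinates, a prefix containing `i` but not `j` has
a nonintegral sum, so its constraint is not tight. Moving weight between `i` and `j` in both
directions then stays inside the polytope. -/
theorem extremePoint_segmentPolytope_integral {x : Fin n → ℝ}
    (hx : x ∈ (segmentPolytope n r s u).extremePoints ℝ) (i : Fin n) : x i = 0 ∨ x i = 1 := by
  classical
  obtain ⟨⟨hx01, hxr, hxs, hxu⟩, hext⟩ := mem_extremePoints.1 hx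
  have hIcc : ∀ l, 0 ≤ x l ∧ x l ≤ 1 := fun l => ⟨hx01.1 l, hx01.2 l⟩
  by_contra hi0
  let F : Finset (Fin n) := {l | ¬(x l = 0 ∨ x l = 1)}
  have hF : ∀ l, l ∈ F ↔ ¬(x l = 0 ∨ x l = 1) := fun l => by simp [F]
  have hFne : F.Nonempty := ⟨i, (hF i).2 hi0⟩
  obtain ⟨i, hiF, hmin⟩ : ∃ i ∈ F, ∀ l ∈ F, i ≤ l :=
    ⟨F.min' hFne, F.min'_mem hFne, fun l hl => F.min'_le l hl⟩
  have hnonint : ∀ m c : ℤ, ((m : ℝ) + x i) ≠ c := by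
    intro m c h
    have h1 : x i = ((c - m : ℤ) : ℝ) := by push_cast; linarith
    have h2 := hIcc i
    rw [h1] at h2
    have h3 : 0 ≤ c - m := by exact_mod_cast h2.1
    have h4 : c - m ≤ 1 := by exact_mod_cast h2.2
    refine (hF i).1 hiF ?_
    rw [h1]
    have : c - m = 0 ∨ c - m = 1 := by omega
    exact_mod_cast this
  have hseg : ∀ k : ℕ, (i : ℕ) < k → (∀ l ∈ F, l ≠ i → k ≤ l) → ∀ c : ℤ, segSum n k x ≠ c := by
    intro k hik hk c
    obtain ⟨m, hm⟩ := exists_int_sum_eq {l : Fin n | l.val < k} x (i := i) (by simpa using hik)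
      (by
        intro l hl hli
        by_contra hcon
        have := hk l ((hF l).2 hcon) hli
        simp at hl
        omega)
    rw [segSum_eq_sum, hm]
    exact hnonint m c
  -- The total sum `r` is an integer, so a single fractional coordinate is impossible.
  have hne2 : (F.erase i).Nonempty := by
    by_contra hcon
    rw [Finset.not_nonempty_iff_eq_empty] at hcon
    refine hseg n i.2 (fun l hl hli => ?_) r (by exact_mod_cast hxr)
    have := Finset.mem_erase.2 ⟨hli, hl⟩
    simp [hcon] at this
  obtain ⟨j, hjF, hjmin⟩ : ∃ j ∈ F.erase i, ∀ l ∈ F.erase i, j ≤ l :=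
    ⟨_, (F.erase i).min'_mem hne2, fun l hl => (F.erase i).min'_le l hl⟩
  have hji : j ≠ i := (Finset.mem_erase.1 hjF).1
  have hij : i < j := lt_of_le_of_ne (hmin j (Finset.mem_erase.1 hjF).2) hji.symm
  have hjF := (Finset.mem_erase.1 hjF).2
  set d : Fin n → ℝ := Pi.single i 1 - Pi.single j 1 with hd
  have hdseg : ∀ k, segSum n k d = 0 ∨ ∀ c : ℤ, segSum n k x ≠ c := by
    intro k
    by_cases h1 : (i : ℕ) < k
    · by_cases h2 : (j : ℕ) < k
      · left
        rw [hd, map_sub, segSum, weightFunctional_single, weightFunctional_single,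
          incidence_of_mem (mem_initSeg.2 h1), incidence_of_mem (mem_initSeg.2 h2), sub_self]
      · right
        refine hseg k h1 fun l hl hli => ?_
        have : j ≤ l := hjmin l (Finset.mem_erase.2 ⟨hli, hl⟩)
        rw [Fin.le_def] at this
        omega
    · left
      have h2 : ¬ (j : ℕ) < k := by rw [Fin.lt_def] at hij; omega
      rw [hd, map_sub, segSum, weightFunctional_single, weightFunctional_single,
        incidence_of_notMem (mem_initSeg.not.2 h1), incidence_of_notMem (mem_initSeg.not.2 h2),
        sub_self]
  have hdcoord : ∀ l, d l = 0 ∨ (x l ≠ 0 ∧ x l ≠ 1) := by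
    intro l
    by_cases h1 : l = i
    · subst h1
      exact Or.inr (not_or.1 ((hF _).1 hiF))
    · by_cases h2 : l = j
      · subst h2
        exact Or.inr (not_or.1 ((hF _).1 hjF))
      · left
        simp [hd, h1, h2]
  have hev : ∀ᶠ ε in 𝓝 (0 : ℝ), x + ε • d ∈ segmentPolytope n r s u := by
    have e1 : ∀ᶠ ε in 𝓝 (0 : ℝ), ∀ l, 0 ≤ x l + ε * d l :=
      eventually_all.2 fun l => eventually_le_add_mul (hIcc l).1 ((hdcoord l).imp_right And.left)
    have e2 : ∀ᶠ ε in 𝓝 (0 : ℝ), ∀ l, x l + ε * d l ≤ 1 :=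
      eventually_all.2 fun l => eventually_add_mul_le (hIcc l).2 ((hdcoord l).imp_right And.right)
    have e3 : ∀ᶠ ε in 𝓝 (0 : ℝ), segSum n s x + ε * segSum n s d ≤ 1 :=
      eventually_add_mul_le hxs ((hdseg s).imp_right fun h => by simpa using h 1)
    have e4 : ∀ᶠ ε in 𝓝 (0 : ℝ), 1 ≤ segSum n u x + ε * segSum n u d :=
      eventually_le_add_mul hxu ((hdseg u).imp_right fun h => by simpa using h 1)
    have hn : segSum n n d = 0 :=
      (hdseg n).resolve_right fun h => h r (by exact_mod_cast hxr)
    filter_upwards [e1, e2, e3, e4] with ε h1 h2 h3 h4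
    refine ⟨⟨fun l => h1 l, fun l => h2 l⟩, ?_, ?_, ?_⟩
    · rw [map_add, map_smul, hn, smul_zero, add_zero, hxr]
    · rwa [map_add, map_smul, smul_eq_mul]
    · rwa [map_add, map_smul, smul_eq_mul]
  obtain ⟨δ, hδ, hball⟩ := Metric.eventually_nhds_iff.1 hev
  have hp := hball (y := δ / 2) (by rw [Real.dist_eq, sub_zero, abs_of_pos] <;> linarith)
  have hm := hball (y := -(δ / 2)) (by
    rw [Real.dist_eq, sub_zero, abs_neg, abs_of_pos] <;> linarith)
  have := (hext _ hp _ hm ⟨1 / 2, 1 / 2, by norm_num, by norm_num, by norm_num, by module⟩).1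
  have := congrFun this i
  simp [hd, hji.symm] at this
  linarith

/-- By Krein–Milman the polytope is the closed hull of its extreme points; being integral, these are
incidence vectors of bases. -/
theorem basePolytope_segmentMatroid (hr : 1 ≤ r) (hsu : s < u) (hu : u + r ≤ n + 1) :
    basePolytope (segmentMatroid hr hsu hu) = segmentPolytope n r s u := by
  refine Set.Subset.antisymm ?_ ?_
  · exact basePolytope_subset_of_convex convex_segmentPolytope fun B hB =>
      incidence_mem_segmentPolytope_iff.2 hB
  · rw [← closure_convexHull_extremePoints (isCompact_segmentPolytope (n := n) (r := r) (s := s)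
      (u := u)) convex_segmentPolytope]
    have hfin : {x | ∃ B, (segmentMatroid hr hsu hu).IsBase B ∧
        x = B.indicator fun _ => (1 : ℝ)}.Finite := by
      refine (Set.finite_range (incidence : Set (Fin n) → _)).subset ?_
      rintro _ ⟨B, -, rfl⟩
      exact ⟨B, rfl⟩
    refine closure_minimal (convexHull_min ?_ (convex_convexHull ℝ _)) (hfin.isClosed_convexHull ℝ)
    intro x hx
    have hxB : x = incidence {i | x i = 1} := by
      ext i
      by_cases h : x i = 1
      · rw [incidence_of_mem (by exact h), h]
      · rw [incidence_of_notMem (by exact h),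
          (extremePoint_segmentPolytope_integral hx i).resolve_right h]
    rw [hxB]
    refine incidence_mem_basePolytope (segmentMatroid_isBase_iff.2 ?_)
    rw [← incidence_mem_segmentPolytope_iff, ← hxB]
    exact hx.1

end SegmentPolytope

/-! ### Decompositions from break sequences -/

section SegmentDecomposition

/-- If no piece contained `x`, all prefix sums up to the last break would inductively stay below 1.
-/
theorem exists_mem_segmentPolytope {n r t : ℕ} {s : ℕ → ℕ} {x : Fin n → ℝ}
    (hx : x ∈ segmentPolytope n r (s 0) (s t)) (ht : 1 ≤ t) :
    ∃ i < t, x ∈ segmentPolytope n r (s i) (s (i + 1)) := by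
  by_contra! hcon
  have : ∀ i < t, segSum n (s i) x ≤ 1 ∧ segSum n (s (i + 1)) x < 1 := by
    intro i
    induction i with
    | zero =>
      intro h
      refine ⟨hx.2.2.1, ?_⟩
      by_contra! h'
      exact hcon 0 h ⟨hx.1, hx.2.1, hx.2.2.1, h'⟩
    | succ i ih =>
      intro h
      have h1 := (ih (by omega)).2.le
      refine ⟨h1, ?_⟩
      by_contra! h'
      exact hcon _ h ⟨hx.1, hx.2.1, h1, h'⟩
  have h := (this (t - 1) (by omega)).2
  rw [Nat.sub_add_cancel ht] at h
  exact absurd hx.2.2.2 (not_le.2 h)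

/-- A strictly increasing sequence from `1` to `n + 1 - r` of length `t`. -/
structure IsBreakSequence (n r t : ℕ) (s : ℕ → ℕ) : Prop where
  zero : s 0 = 1
  last : s t + r = n + 1
  lt_succ : ∀ i < t, s i < s (i + 1)

namespace IsBreakSequence

variable {n r t : ℕ} {s : ℕ → ℕ}

theorem lt (hs : IsBreakSequence n r t s) {i j : ℕ} (hij : i < j) (hj : j ≤ t) : s i < s j := by
  induction j, hij using Nat.le_induction with
  | base => exact hs.lt_succ i (by omega)
  | succ k hk ih => exact (ih (by omega)).trans (hs.lt_succ k (by omega))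

theorem le (hs : IsBreakSequence n r t s) {i j : ℕ} (hij : i ≤ j) (hj : j ≤ t) : s i ≤ s j := by
  obtain rfl | h := hij.eq_or_lt
  · rfl
  · exact (hs.lt h hj).le

theorem add_le (hs : IsBreakSequence n r t s) {i : ℕ} (hi : i ≤ t) : s i + r ≤ n + 1 := by
  rw [← hs.last]
  exact Nat.add_le_add_right (hs.le hi le_rfl) r

theorem one_le (hs : IsBreakSequence n r t s) {i : ℕ} (hi : i ≤ t) : 1 ≤ s i :=
  hs.zero ▸ hs.le (Nat.zero_le i) hi

/-- The matroids cut out by a break sequence. -/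
def piece (hs : IsBreakSequence n r t s) (hr : 1 ≤ r) (i : Fin t) : Matroid (Fin n) :=
  segmentMatroid hr (hs.lt_succ i i.2) (hs.add_le i.2)

theorem basePolytope_piece (hs : IsBreakSequence n r t s) (hr : 1 ≤ r) (i : Fin t) :
    basePolytope (hs.piece hr i) = segmentPolytope n r (s i) (s (i + 1)) :=
  basePolytope_segmentMatroid _ _ _

/-- Prefix sums of length at least `s (i + 1)` are at least 1 on piece `i`, and that of length `s j`
is at most 1 on piece `j`. The common part is thus where a valid inequality is tight. -/
theorem inter_eq_left (hs : IsBreakSequence n r t s) {i j : ℕ} (hij : i < j) (hj : j < t) :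
    segmentPolytope n r (s i) (s (i + 1)) ∩ segmentPolytope n r (s j) (s (j + 1)) =
      {x | x ∈ segmentPolytope n r (s i) (s (i + 1)) ∧ segSum n (s j) x = 1} := by
  ext x
  constructor
  · rintro ⟨h, h'⟩
    exact ⟨h, h'.2.2.1.antisymm
      (h.2.2.2.trans (segSum_mono h.1 (hs.le (show i + 1 ≤ j from hij) hj.le)))⟩
  · rintro ⟨h, h'⟩
    exact ⟨h, h.1, h.2.1, h'.le, h'.ge.trans (segSum_mono h.1 (hs.lt_succ j hj).le)⟩

theorem inter_eq_right (hs : IsBreakSequence n r t s) {i j : ℕ} (hij : i < j) (hj : j < t) :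
    segmentPolytope n r (s i) (s (i + 1)) ∩ segmentPolytope n r (s j) (s (j + 1)) =
      {x | x ∈ segmentPolytope n r (s j) (s (j + 1)) ∧ segSum n (s (i + 1)) x = 1} := by
  ext x
  constructor
  · rintro ⟨h, h'⟩
    exact ⟨h', h.2.2.2.antisymm'
      ((segSum_mono h.1 (hs.le (show i + 1 ≤ j from hij) hj.le)).trans h'.2.2.1)⟩
  · rintro ⟨h, h'⟩
    exact ⟨⟨h.1, h.2.1, (segSum_mono h.1 (hs.lt_succ i (hij.trans hj)).le).trans h'.le, h'.ge⟩, h⟩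

theorem isExposed_inter_left (hs : IsBreakSequence n r t s) {i j : ℕ} (hij : i < j) (hj : j < t) :
    IsExposed ℝ (segmentPolytope n r (s i) (s (i + 1)))
      (segmentPolytope n r (s i) (s (i + 1)) ∩ segmentPolytope n r (s j) (s (j + 1))) := by
  rw [hs.inter_eq_left hij hj]
  rintro ⟨z, hz, hz1⟩
  have hge : ∀ y ∈ segmentPolytope n r (s i) (s (i + 1)), 1 ≤ segSum n (s j) y := fun y hy =>
    hy.2.2.2.trans (segSum_mono hy.1 (hs.le (show i + 1 ≤ j from hij) hj.le))
  refine ⟨-segSum n (s j), ?_⟩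
  ext x
  refine and_congr_right fun hx => ?_
  simp only [neg_apply, neg_le_neg_iff]
  exact ⟨fun h y hy => h.le.trans (hge y hy), fun h => ((h z hz).trans_eq hz1).antisymm (hge x hx)⟩

theorem isExposed_inter_right (hs : IsBreakSequence n r t s) {i j : ℕ} (hij : i < j) (hj : j < t) :
    IsExposed ℝ (segmentPolytope n r (s j) (s (j + 1)))
      (segmentPolytope n r (s i) (s (i + 1)) ∩ segmentPolytope n r (s j) (s (j + 1))) := by
  rw [hs.inter_eq_right hij hj]
  rintro ⟨z, hz, hz1⟩
  have hle : ∀ y ∈ segmentPolytope n r (s j) (s (j + 1)), segSum n (s (i + 1)) y ≤ 1 := fun y hy =>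
    (segSum_mono hy.1 (hs.le (show i + 1 ≤ j from hij) hj.le)).trans hy.2.2.1
  refine ⟨segSum n (s (i + 1)), ?_⟩
  ext x
  refine and_congr_right fun hx => ?_
  exact ⟨fun h y hy => (hle y hy).trans h.ge, fun h => (hle x hx).antisymm (hz1.ge.trans (h z hz))⟩

theorem segmentPolytope_subset (hs : IsBreakSequence n r t s) {i : ℕ} (hi : i < t) :
    segmentPolytope n r (s i) (s (i + 1)) ⊆ segmentPolytope n r (s 0) (s t) := fun _ hx =>
  ⟨hx.1, hx.2.1, (segSum_mono hx.1 (hs.le (Nat.zero_le i) hi.le)).trans hx.2.2.1,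
    hx.2.2.2.trans (segSum_mono hx.1 (hs.le hi le_rfl))⟩

theorem not_segmentPolytope_subset (hs : IsBreakSequence n r t s) (hr : 2 ≤ r) {i j : ℕ}
    (hi : i < t) (hj : j < t) (hij : i ≠ j) :
    ¬ segmentPolytope n r (s i) (s (i + 1)) ⊆ segmentPolytope n r (s j) (s (j + 1)) := by
  intro h
  have hsub : ∀ B, IsSegmentBase n r (s i) (s (i + 1)) B → IsSegmentBase n r (s j) (s (j + 1)) B :=
    fun B hB => incidence_mem_segmentPolytope_iff.1 (h (incidence_mem_segmentPolytope_iff.2 hB))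
  have h1 := hs.lt_succ i hi
  have h2 := hs.add_le (show i + 1 ≤ t from hi)
  have h3 := hs.one_le hi.le
  obtain hij | hij := hij.lt_or_gt
  · have h4 := hs.le (show i + 1 ≤ j from hij) hj.le
    -- This base contains `0` and `s i`, both among the first `s j` elements.
    have hB := hsub _ (isSegmentBase_pair_insert_compl hr h3 h1 h2 ⟨0, by omega⟩ ⟨s i, by omega⟩
      rfl rfl)
    have := hB.subsingleton (x := ⟨0, by omega⟩) ⟨by simp, by rw [mem_initSeg]; simp; omega⟩
      (y := ⟨s i, by omega⟩) ⟨by simp, by rw [mem_initSeg]; simp; omega⟩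
    rw [Fin.mk.injEq] at this
    omega
  · have h4 := hs.le (show j + 1 ≤ i from hij) hi.le
    -- The smallest element of this base is `s i`, so it misses the first `s (j + 1)` elements.
    have hB := hsub _ (isSegmentBase_insert_compl (by omega) h1 h2 ⟨s i, by omega⟩ le_rfl h1)
    obtain ⟨a, rfl | ha, ha'⟩ := hB.nonempty
    · rw [mem_initSeg] at ha'
      simp only at ha'
      omega
    · rw [Set.mem_compl_iff, mem_initSeg] at ha
      rw [mem_initSeg] at ha'
      omega

theorem isDecomposition (hs : IsBreakSequence n r t s) (hr : 2 ≤ r) (ht : 1 ≤ t) :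
    IsDecomposition (uniformMatroid n r) (hs.piece (by omega)) where
  ground_eq _ := rfl
  eq_iUnion := by
    have h1 := hs.lt (show 0 < t from ht) le_rfl
    have h2 := hs.last
    have h3 := hs.zero
    rw [uniformMatroid_eq_segmentMatroid (by omega) (by omega), basePolytope_segmentMatroid]
    have h4 : segmentPolytope n r 1 (n + 1 - r) = segmentPolytope n r (s 0) (s t) := by
      rw [h3, ← h2, Nat.add_sub_cancel]
    simp only [basePolytope_piece]
    rw [h4]
    ext x
    rw [Set.mem_iUnion]
    constructor
    · intro hx
      obtain ⟨i, hi, h⟩ := exists_mem_segmentPolytope hx ht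
      exact ⟨⟨i, hi⟩, h⟩
    · rintro ⟨i, h⟩
      exact hs.segmentPolytope_subset i.2 h
  face_left i j hij := by
    simp only [basePolytope_piece]
    obtain h | h := (Fin.val_ne_of_ne hij).lt_or_gt
    · exact hs.isExposed_inter_left h j.2
    · rw [Set.inter_comm]
      exact hs.isExposed_inter_right h i.2
  face_right i j hij := by
    simp only [basePolytope_piece]
    obtain h | h := (Fin.val_ne_of_ne hij).lt_or_gt
    · exact hs.isExposed_inter_right h j.2
    · rw [Set.inter_comm]
      exact hs.isExposed_inter_left h i.2
  not_subset i j hij := by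
    simp only [basePolytope_piece]
    exact hs.not_segmentPolytope_subset hr i.2 j.2 (Fin.val_ne_of_ne hij)

end IsBreakSequence

end SegmentDecomposition

/-! ### Degrees of the bases of a piece -/

section SegmentDegrees

variable {n r s u : ℕ}

theorem IsSegmentBase.isSegmentBase_exchange_iff {B : Set (Fin n)} (hB : IsSegmentBase n r s u B)
    {e f : Fin n} (he : e ∈ B) (hf : f ∉ B) :
    IsSegmentBase n r s u (insert f (B \ {e})) ↔
      ¬(f ∈ initSeg n s ∧ (B \ {e} ∩ initSeg n s).Nonempty) ∧
      ¬(f ∉ initSeg n u ∧ B \ {e} ∩ initSeg n u = ∅) := by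
  constructor
  · intro h
    constructor
    · rintro ⟨h1, a, ha, ha'⟩
      have := h.subsingleton ⟨Set.mem_insert _ _, h1⟩ ⟨Set.mem_insert_of_mem _ ha, ha'⟩
      exact hf (this ▸ ha.1)
    · rintro ⟨h1, h2⟩
      obtain ⟨a, rfl | ha, ha'⟩ := h.nonempty
      · exact h1 ha'
      · have : a ∈ B \ {e} ∩ initSeg n u := ⟨ha, ha'⟩
        rw [h2] at this
        exact this
  · rintro ⟨h1, h2⟩
    refine ⟨?_, ?_, ?_⟩
    · rw [Set.ncard_exchange hf he, hB.ncard_eq]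
    · by_cases hfs : f ∈ initSeg n s
      · have : B \ {e} ∩ initSeg n s = ∅ := by
          rw [← Set.not_nonempty_iff_eq_empty]
          exact fun h => h1 ⟨hfs, h⟩
        rw [Set.insert_inter_of_mem hfs, this]
        simp
      · rw [Set.insert_inter_of_notMem hfs]
        exact hB.subsingleton.anti (Set.inter_subset_inter_left _ Set.sdiff_subset)
    · by_cases hfu : f ∈ initSeg n u
      · exact ⟨f, Set.mem_insert _ _, hfu⟩
      · obtain ⟨a, ha, ha'⟩ := Set.nonempty_iff_ne_empty.2 fun h => h2 ⟨hfu, h⟩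
        exact ⟨a, Set.mem_insert_of_mem _ ha, ha'⟩

theorem baseDegree_eq_ncard_exchanges {α : Type*} [Finite α] {M : Matroid α} {B : Set α}
    (hB : M.IsBase B) :
    baseDegree M B = {p | p ∈ B ×ˢ Bᶜ ∧ M.IsBase (insert p.2 (B \ {p.1}))}.ncard := by
  have hinj : Set.InjOn (fun p : α × α => insert p.2 (B \ {p.1}))
      {p | p ∈ B ×ˢ Bᶜ ∧ M.IsBase (insert p.2 (B \ {p.1}))} := by
    rintro ⟨e, f⟩ ⟨⟨he, hf⟩, -⟩ ⟨e', f'⟩ ⟨⟨he', hf'⟩, -⟩ h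
    simp only [Set.mem_compl_iff] at he hf he' hf' h
    have h1 : f = f' := by
      have : f ∈ insert f' (B \ {e'}) := h ▸ Set.mem_insert _ _
      exact this.resolve_right fun h => hf h.1
    have h2 : e = e' := by
      by_contra hne
      have : e ∈ insert f (B \ {e}) := h ▸ Set.mem_insert_of_mem _ ⟨he, hne⟩
      obtain rfl | h := this
      · exact hf he
      · exact h.2 rfl
    rw [h1, h2]
  rw [baseDegree, ← hinj.ncard_image]
  congr 1
  ext C
  constructor
  · rintro ⟨hC, h⟩
    obtain ⟨e, he⟩ := Set.ncard_eq_one.1 h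
    have he' : e ∈ B \ C := he ▸ rfl
    obtain ⟨f, hf⟩ := Set.ncard_eq_one.1 ((hB.ncard_sdiff_comm hC).symm.trans h)
    have hf' : f ∈ C \ B := hf ▸ rfl
    have heq : insert f (B \ {e}) = C := by
      rw [← he, ← Set.singleton_union, ← hf, Set.sdiff_sdiff_right_self, Set.inter_comm,
        Set.sdiff_union_inter]
    exact ⟨(e, f), ⟨⟨he'.1, hf'.2⟩, by simpa only [heq] using hC⟩, heq⟩
  · rintro ⟨⟨e, f⟩, ⟨⟨he, hf⟩, h⟩, rfl⟩
    refine ⟨h, Set.ncard_eq_one.2 ⟨e, ?_⟩⟩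
    simp only [Set.mem_compl_iff] at he hf h
    ext a
    simp only [Set.mem_sdiff, Set.mem_insert_iff, Set.mem_singleton_iff]
    constructor
    · rintro ⟨h1, h2⟩
      by_contra h3
      exact h2 (Or.inr ⟨h1, h3⟩)
    · rintro rfl
      refine ⟨he, ?_⟩
      rintro (rfl | h)
      · exact hf he
      · exact h.2 rfl

open Classical in
-- If `a` is the element of `B` in the segment, the bad exchanges keep `a` and bring in another
-- element of the segment.
theorem IsSegmentBase.ncard_first_obstruction {B : Set (Fin n)} (hB : IsSegmentBase n r s u B)
    (hs : s ≤ n) :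
    {p | p ∈ B ×ˢ Bᶜ ∧ (p.2 ∈ initSeg n s ∧ (B \ {p.1} ∩ initSeg n s).Nonempty)}.ncard =
      if (B ∩ initSeg n s).Nonempty then (r - 1) * (s - 1) else 0 := by
  split_ifs with h
  · obtain ⟨a, haB, has⟩ := h
    have huniq : ∀ b ∈ B, b ∈ initSeg n s → b = a := fun b h1 h2 =>
      hB.subsingleton ⟨h1, h2⟩ ⟨haB, has⟩
    rw [← hB.ncard_eq, ← Set.ncard_sdiff_singleton_of_mem haB]
    conv_rhs => rw [← ncard_initSeg hs, ← Set.ncard_sdiff_singleton_of_mem has, ← Set.ncard_prod]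
    congr 1
    ext ⟨e, f⟩
    simp only [Set.mem_prod, Set.mem_compl_iff, Set.mem_sdiff, Set.mem_singleton_iff,
      Set.mem_ofPred_eq]
    constructor
    · rintro ⟨⟨he, hf⟩, hfs, b, ⟨hb, hbe⟩, hbs⟩
      refine ⟨⟨he, ?_⟩, hfs, ?_⟩
      · rintro rfl
        exact hbe (huniq b hb hbs)
      · rintro rfl
        exact hf haB
    · rintro ⟨⟨he, hea⟩, hfs, hfa⟩
      exact ⟨⟨he, fun hf => hfa (huniq f hf hfs)⟩, hfs, a, ⟨haB, Ne.symm hea⟩, has⟩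
  · rw [Set.ncard_eq_zero, Set.eq_empty_iff_forall_notMem]
    rintro ⟨e, f⟩ ⟨-, -, b, hb, hb'⟩
    exact h ⟨b, hb.1, hb'⟩

open Classical in
-- Bad exchanges remove the only element of `B` in the segment and bring in one outside both `B` and
-- the segment.
theorem IsSegmentBase.ncard_second_obstruction {B : Set (Fin n)} (hB : IsSegmentBase n r s u B)
    (hu : u ≤ n) :
    {p | p ∈ B ×ˢ Bᶜ ∧ (p.2 ∉ initSeg n u ∧ B \ {p.1} ∩ initSeg n u = ∅)}.ncard =
      if (B ∩ initSeg n u).Subsingleton then n + 1 - r - u else 0 := by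
  split_ifs with h
  · obtain ⟨b, hbB, hbu⟩ := hB.nonempty
    have hb : B ∩ initSeg n u = {b} := h.eq_singleton_of_mem ⟨hbB, hbu⟩
    have hcard : ((B ∪ initSeg n u)ᶜ).ncard = n + 1 - r - u := by
      have h1 := Set.ncard_union_add_ncard_inter B (initSeg n u)
      rw [hb, Set.ncard_singleton, hB.ncard_eq, ncard_initSeg hu] at h1
      rw [Set.ncard_compl, Nat.card_eq_fintype_card, Fintype.card_fin]
      omega
    rw [← hcard, ← one_mul (B ∪ initSeg n u)ᶜ.ncard, ← Set.ncard_singleton b, ← Set.ncard_prod]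
    congr 1
    ext ⟨e, f⟩
    simp only [Set.mem_prod, Set.mem_compl_iff, Set.mem_union, Set.mem_singleton_iff,
      Set.mem_ofPred_eq, not_or]
    constructor
    · rintro ⟨⟨he, hf⟩, hfu, hemp⟩
      refine ⟨?_, hf, hfu⟩
      by_contra hne
      have : b ∈ B \ {e} ∩ initSeg n u := ⟨⟨hbB, Ne.symm hne⟩, hbu⟩
      rw [hemp] at this
      exact this
    · rintro ⟨rfl, hf, hfu⟩
      refine ⟨⟨hbB, hf⟩, hfu, ?_⟩
      rw [Set.eq_empty_iff_forall_notMem]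
      rintro a ⟨⟨ha, hae⟩, hau⟩
      exact hae (h ⟨ha, hau⟩ ⟨hbB, hbu⟩)
  · rw [Set.ncard_eq_zero, Set.eq_empty_iff_forall_notMem]
    rintro ⟨e, f⟩ ⟨-, -, hemp⟩
    refine h fun a ha b hb => ?_
    have key : ∀ c ∈ B ∩ initSeg n u, c = e := by
      rintro c ⟨hc, hcu⟩
      by_contra hne
      have : c ∈ B \ {e} ∩ initSeg n u := ⟨⟨hc, hne⟩, hcu⟩
      simp only at hemp
      rw [hemp] at this
      exact this
    rw [key a ha, key b hb]

open Classical in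
-- All `r * (n - r)` exchanges are counted. The two obstructions are disjoint: one needs `f` in the
-- smaller segment, the other `f` outside the larger.
theorem IsSegmentBase.baseDegree_add {hr : 1 ≤ r} {hsu : s < u} {hu : u + r ≤ n + 1}
    {B : Set (Fin n)} (hB : IsSegmentBase n r s u B) :
    baseDegree (segmentMatroid hr hsu hu) B +
      ((if (B ∩ initSeg n s).Nonempty then (r - 1) * (s - 1) else 0) +
      (if (B ∩ initSeg n u).Subsingleton then n + 1 - r - u else 0)) = r * (n - r) := by
  rw [← hB.ncard_first_obstruction (by omega), ← hB.ncard_second_obstruction (by omega),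
    baseDegree_eq_ncard_exchanges (segmentMatroid_isBase_iff.2 hB), ← Set.ncard_union_eq,
    ← Set.ncard_union_eq]
  · have : r * (n - r) = (B ×ˢ Bᶜ).ncard := by
      rw [Set.ncard_prod, Set.ncard_compl, hB.ncard_eq, Nat.card_eq_fintype_card, Fintype.card_fin]
    rw [this]
    congr 1
    ext ⟨e, f⟩
    simp only [Set.mem_union, Set.mem_ofPred_eq, ← and_or_left, segmentMatroid_isBase_iff]
    rw [and_iff_left_iff_imp]
    rintro ⟨he, hf⟩
    rw [hB.isSegmentBase_exchange_iff he hf]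
    tauto
  · rw [Set.disjoint_left]
    rintro ⟨e, f⟩ ⟨⟨he, hf⟩, h⟩
    rw [segmentMatroid_isBase_iff, hB.isSegmentBase_exchange_iff he hf] at h
    rintro (⟨-, h'⟩ | ⟨-, h'⟩)
    · exact h.1 h'
    · exact h.2 h'
  · rw [Set.disjoint_left]
    rintro ⟨e, f⟩ ⟨-, h, -⟩ ⟨-, h', -⟩
    exact h' (initSeg_mono n hsu.le h)

theorem baseDegree_segmentMatroid_cases {hr : 1 ≤ r} {hsu : s < u} {hu : u + r ≤ n + 1}
    {B : Set (Fin n)} (hB : (segmentMatroid hr hsu hu).IsBase B) {x y D : ℕ}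
    (hx : x = n + 1 - r - u) (hy : y = (r - 1) * (s - 1)) (hD : D = r * (n - r)) :
    baseDegree (segmentMatroid hr hsu hu) B = D ∨
      baseDegree (segmentMatroid hr hsu hu) B + x = D ∨
      baseDegree (segmentMatroid hr hsu hu) B + y = D ∨
      baseDegree (segmentMatroid hr hsu hu) B + x + y = D := by
  have := (segmentMatroid_isBase_iff.1 hB).baseDegree_add (hr := hr) (hsu := hsu) (hu := hu)
  rw [← hx, ← hy, ← hD] at this
  split_ifs at this <;> omega

theorem exists_baseDegree_segmentMatroid {hr : 2 ≤ r} {hsu : s < u} {hu : u + r ≤ n + 1}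
    (hs : 1 ≤ s) {x y D : ℕ} (hx : x = n + 1 - r - u) (hy : y = (r - 1) * (s - 1))
    (hD : D = r * (n - r)) :
    (∃ B, (segmentMatroid (one_le_two.trans hr) hsu hu).IsBase B ∧
      baseDegree (segmentMatroid (one_le_two.trans hr) hsu hu) B + x = D) ∧
    (∃ B, (segmentMatroid (one_le_two.trans hr) hsu hu).IsBase B ∧
      baseDegree (segmentMatroid (one_le_two.trans hr) hsu hu) B + y = D) ∧
    (∃ B, (segmentMatroid (one_le_two.trans hr) hsu hu).IsBase B ∧
      baseDegree (segmentMatroid (one_le_two.trans hr) hsu hu) B + x + y = D) := by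
  have hr1 : 1 ≤ r := one_le_two.trans hr
  refine ⟨⟨_, isSegmentBase_insert_compl hr1 hsu hu ⟨s, by omega⟩ le_rfl hsu, ?_⟩,
    ⟨_, isSegmentBase_pair_insert_compl hr hs hsu hu ⟨0, by omega⟩ ⟨s, by omega⟩ rfl rfl, ?_⟩,
    ⟨_, isSegmentBase_zero_insert_compl hr1 hs hsu hu ⟨0, by omega⟩ rfl, ?_⟩⟩
  · have hB := isSegmentBase_insert_compl hr1 hsu hu ⟨s, by omega⟩ le_rfl hsu
    have := hB.baseDegree_add (hr := hr1) (hsu := hsu) (hu := hu)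
    rw [← hx, ← hy, ← hD, if_neg, if_pos] at this
    · omega
    · refine (Set.subsingleton_singleton (a := ⟨s, by omega⟩)).anti ?_
      rintro a ⟨ha | ha, has⟩
      · exact ha
      · rw [Set.mem_compl_iff, mem_initSeg] at ha
        rw [mem_initSeg] at has
        omega
    · rintro ⟨a, rfl | ha, has⟩
      · simp [mem_initSeg] at has
      · rw [Set.mem_compl_iff, mem_initSeg] at ha
        rw [mem_initSeg] at has
        omega
  · have hB := isSegmentBase_pair_insert_compl hr hs hsu hu ⟨0, by omega⟩ ⟨s, by omega⟩ rfl rfl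
    have := hB.baseDegree_add (hr := hr1) (hsu := hsu) (hu := hu)
    rw [← hx, ← hy, ← hD, if_pos, if_neg] at this
    · omega
    · intro h
      have := h (x := ⟨0, by omega⟩) ⟨by simp, by rw [mem_initSeg]; simp; omega⟩
        (y := ⟨s, by omega⟩) ⟨by simp, by rw [mem_initSeg]; simp; omega⟩
      rw [Fin.mk.injEq] at this
      omega
    · exact ⟨⟨0, by omega⟩, by simp, by rw [mem_initSeg]; simp; omega⟩
  · have hB := isSegmentBase_zero_insert_compl hr1 hs hsu hu ⟨0, by omega⟩ rfl
    have := hB.baseDegree_add (hr := hr1) (hsu := hsu) (hu := hu)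
    rw [← hx, ← hy, ← hD, if_pos, if_pos] at this
    · omega
    · refine (Set.subsingleton_singleton (a := ⟨0, by omega⟩)).anti ?_
      rintro a ⟨ha | ha, has⟩
      · exact ha
      · rw [Set.mem_compl_iff, mem_initSeg] at ha
        rw [mem_initSeg] at has
        omega
    · exact ⟨⟨0, by omega⟩, by simp, by rw [mem_initSeg]; simp; omega⟩

theorem deficits_cases_of_baseDegrees_eq {hr : 2 ≤ r} {s' u' x y x' y' : ℕ} {hsu : s < u}
    {hu : u + r ≤ n + 1} {hsu' : s' < u'} {hu' : u' + r ≤ n + 1} (hs : 1 ≤ s)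
    (hx : x = n + 1 - r - u) (hy : y = (r - 1) * (s - 1))
    (hx' : x' = n + 1 - r - u') (hy' : y' = (r - 1) * (s' - 1))
    (hdeg : {d | ∃ B, (segmentMatroid (one_le_two.trans hr) hsu hu).IsBase B ∧
        baseDegree (segmentMatroid (one_le_two.trans hr) hsu hu) B = d} =
      {d | ∃ B, (segmentMatroid (one_le_two.trans hr) hsu' hu').IsBase B ∧
        baseDegree (segmentMatroid (one_le_two.trans hr) hsu' hu') B = d}) :
    (x = 0 ∨ x = x' ∨ x = y' ∨ x = x' + y') ∧ (y = 0 ∨ y = x' ∨ y = y' ∨ y = x' + y') ∧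
      x + y ≤ x' + y' := by
  obtain ⟨D, hD⟩ : ∃ D, D = r * (n - r) := ⟨_, rfl⟩
  obtain ⟨⟨B₁, hB₁, h₁⟩, ⟨B₂, hB₂, h₂⟩, ⟨B₃, hB₃, h₃⟩⟩ :=
    exists_baseDegree_segmentMatroid (hr := hr) (hsu := hsu) (hu := hu) hs hx hy hD
  have step : ∀ d, (∃ B, (segmentMatroid (one_le_two.trans hr) hsu hu).IsBase B ∧
      baseDegree (segmentMatroid (one_le_two.trans hr) hsu hu) B = d) →
      d = D ∨ d + x' = D ∨ d + y' = D ∨ d + x' + y' = D := by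
    intro d hd
    obtain ⟨C, hC, rfl⟩ := (Set.ext_iff.1 hdeg d).1 hd
    exact baseDegree_segmentMatroid_cases hC hx' hy' hD
  have s₁ := step _ ⟨B₁, hB₁, rfl⟩
  have s₂ := step _ ⟨B₂, hB₂, rfl⟩
  have s₃ := step _ ⟨B₃, hB₃, rfl⟩
  refine ⟨?_, ?_, ?_⟩ <;> omega

/-- The largest loss gives `x + y = x' + y'`. Since the losses `x` and `y` also occur on the other
side, and conversely, the pairs agree up to order. -/
theorem deficits_eq_of_combEquiv {hr : 2 ≤ r} {s' u' x y x' y' : ℕ} {hsu : s < u}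
    {hu : u + r ≤ n + 1} {hsu' : s' < u'} {hu' : u' + r ≤ n + 1} (hs : 1 ≤ s) (hs' : 1 ≤ s')
    (hx : x = n + 1 - r - u) (hy : y = (r - 1) * (s - 1))
    (hx' : x' = n + 1 - r - u') (hy' : y' = (r - 1) * (s' - 1))
    (h : CombEquiv (basePolytope (segmentMatroid (one_le_two.trans hr) hsu hu))
      (basePolytope (segmentMatroid (one_le_two.trans hr) hsu' hu'))) :
    (x = x' ∧ y = y') ∨ (x = y' ∧ y = x') := by
  have k₁ := deficits_cases_of_baseDegrees_eq (hr := hr) hs hx hy hx' hy' h.baseDegrees_eq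
  have k₂ := deficits_cases_of_baseDegrees_eq (hr := hr) hs' hx' hy' hx hy h.baseDegrees_eq.symm
  omega

end SegmentDegrees

/-! ### Recovering the breaks from the degree losses -/

section BreakSequenceRecovery

/-- The map `v ↦ K - c * (v - 1)` preserves the support, which contains no fixed point since `f`
changes sign. For `c ≥ 2` the map stretches distances, so comparing maximum and minimum leaves a
single, hence fixed, point. For `c = 1` it is a reflection, and a support on one side of its centre
again forces a fixed point. -/
theorem eq_zero_of_reflection {f : ℤ → ℤ} {c K N : ℤ} (hf : ∀ v, f (K - c * (v - 1)) + f v = 0)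
    (hsupp : ∀ v, f v ≠ 0 → 0 ≤ v ∧ v ≤ N)
    (hc : 2 ≤ c ∨ c = 1 ∧ ∀ v, f v ≠ 0 → 2 * v ≤ K + 1) (v : ℤ) : f v = 0 := by
  by_contra hv
  let F : Finset ℤ := {v ∈ Finset.Icc 0 N | f v ≠ 0}
  have hF : ∀ v, v ∈ F ↔ f v ≠ 0 := fun v => by
    simp only [F, Finset.mem_filter, Finset.mem_Icc, and_iff_right_iff_imp]
    exact hsupp v
  have hne : F.Nonempty := ⟨v, (hF v).2 hv⟩
  obtain ⟨a, haF, ha⟩ : ∃ a ∈ F, ∀ v ∈ F, v ≤ a := ⟨_, F.max'_mem hne, fun v hv => F.le_max' v hv⟩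
  obtain ⟨b, hbF, hb⟩ : ∃ b ∈ F, ∀ v ∈ F, b ≤ v := ⟨_, F.min'_mem hne, fun v hv => F.min'_le v hv⟩
  have hrefl : ∀ v ∈ F, K - c * (v - 1) ∈ F := fun v hv => by
    rw [hF] at hv ⊢
    intro h
    have := hf v
    omega
  have hfix : ∀ v ∈ F, K - c * (v - 1) ≠ v := fun v hv h => by
    have := hf v
    rw [h] at this
    exact (hF v).1 hv (by omega)
  have h1 := ha _ (hrefl b hbF)
  have h2 := hb _ (hrefl a haF)
  have h3 := hb a haF
  obtain hc | ⟨rfl, hc⟩ := hc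
  · have hab : a = b := by nlinarith
    subst hab
    exact hfix a haF (h1.antisymm h2)
  · have h4 := hc a ((hF a).1 haF)
    have h5 := ha _ (hrefl a haF)
    exact hfix a haF (by omega)

/-- How often a value is taken by `s 1, …, s m`. -/
def occurrences (s : ℕ → ℕ) (m : ℕ) (v : ℤ) : ℤ :=
  ∑ i ∈ Finset.range m, if (s (i + 1) : ℤ) = v then 1 else 0

theorem occurrences_ne_zero {s : ℕ → ℕ} {m : ℕ} {v : ℤ} :
    occurrences s m v ≠ 0 ↔ ∃ i < m, (s (i + 1) : ℤ) = v := by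
  rw [occurrences, ← not_iff_not, not_not, Finset.sum_eq_zero_iff_of_nonneg]
  · simp
  · intro i _
    split_ifs <;> simp

namespace IsBreakSequence

variable {n r t : ℕ} {s s' : ℕ → ℕ}

/-- The last piece has `x = 0` and the first has `y = 0`; shifting the index groups the other losses
by inner break. -/
theorem sum_deficits (hs : IsBreakSequence n r (t + 1) s) (g : ℕ → ℤ) :
    ∑ i : Fin (t + 1), (g (n + 1 - r - s (i + 1)) + g ((r - 1) * (s i - 1))) =
      ∑ i ∈ Finset.range t, (g (n + 1 - r - s (i + 1)) + g ((r - 1) * (s (i + 1) - 1))) +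
        2 * g 0 := by
  rw [Fin.sum_univ_eq_sum_range
    (fun i => g (n + 1 - r - s (i + 1)) + g ((r - 1) * (s i - 1))) (t + 1),
    Finset.sum_add_distrib, Finset.sum_range_succ, Finset.sum_range_succ' (n := t),
    Finset.sum_add_distrib, hs.zero]
  have h := hs.last
  rw [show n + 1 - r - s (t + 1) = 0 by omega, show (r - 1) * (1 - 1) = 0 by simp]
  ring

theorem sum_indicator_deficits (hs : IsBreakSequence n r (t + 1) s) (hr : 2 ≤ r) (v : ℤ) :
    ∑ i ∈ Finset.range t,
      ((if ((n + 1 - r - s (i + 1) : ℕ) : ℤ) = (r - 1) * (v - 1) then 1 else 0) +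
        (if (((r - 1) * (s (i + 1) - 1) : ℕ) : ℤ) = (r - 1) * (v - 1) then 1 else 0)) =
      occurrences s t (n + 1 - r - (r - 1) * (v - 1)) + occurrences s t v := by
  rw [Finset.sum_add_distrib, occurrences, occurrences]
  congr 1 <;> refine Finset.sum_congr rfl fun i hi => ?_
  · have h1 := hs.add_le (show i + 1 ≤ t + 1 by simp at hi; omega)
    have h2 : ((n + 1 - r - s (i + 1) : ℕ) : ℤ) = n + 1 - r - s (i + 1) := by omega
    rw [h2]
    congr 1
    exact propext ⟨fun h => by linarith, fun h => by linarith⟩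
  · have h1 := hs.one_le (show i + 1 ≤ t + 1 by simp at hi; omega)
    have hr0 : (r : ℤ) - 1 ≠ 0 := by omega
    have h2 : (((r - 1) * (s (i + 1) - 1) : ℕ) : ℤ) = (r - 1) * (s (i + 1) - 1) := by
      rw [Nat.cast_mul, Nat.cast_sub (by omega), Nat.cast_sub h1, Nat.cast_one]
    rw [h2]
    congr 1
    rw [mul_right_inj' hr0, sub_left_inj]

theorem eq_of_combEquiv (hs : IsBreakSequence n r t s) (hs' : IsBreakSequence n r t s')
    (hr : 2 ≤ r) (hn : ∀ i < t, 2 * s i ≤ n) (hn' : ∀ i < t, 2 * s' i ≤ n)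
    (σ : Equiv.Perm (Fin t))
    (h : ∀ i, CombEquiv (basePolytope (hs.piece (one_le_two.trans hr) i))
      (basePolytope (hs'.piece (one_le_two.trans hr) (σ i)))) :
    ∀ i < t, s i = s' i := by
  obtain _ | t := t
  · simp
  -- Equality for every `g` expresses equality of multisets of losses; each summand is symmetric, so
  -- swapped pairs do no harm.
  have hsum : ∀ g : ℕ → ℤ,
      ∑ i : Fin (t + 1), (g (n + 1 - r - s (i + 1)) + g ((r - 1) * (s i - 1))) =
        ∑ i : Fin (t + 1), (g (n + 1 - r - s' (i + 1)) + g ((r - 1) * (s' i - 1))) := by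
    intro g
    rw [← Equiv.sum_comp σ fun i : Fin (t + 1) =>
      g (n + 1 - r - s' (i + 1)) + g ((r - 1) * (s' i - 1))]
    refine Finset.sum_congr rfl fun i _ => ?_
    obtain ⟨h1, h2⟩ | ⟨h1, h2⟩ := deficits_eq_of_combEquiv (hr := hr) (hs.one_le i.2.le)
      (hs'.one_le (σ i).2.le) rfl rfl rfl rfl (h i)
    · rw [h1, h2]
    · rw [h1, h2, add_comm]
  replace hsum := fun g => (hs.sum_deficits g).symm.trans ((hsum g).trans (hs'.sum_deficits g))
  have hocc : ∀ v, occurrences s t v - occurrences s' t v = 0 := by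
    have hsupp : ∀ v, occurrences s t v - occurrences s' t v ≠ 0 → 0 ≤ v ∧ 2 * v ≤ n := by
      intro v hv
      obtain hv | hv : occurrences s t v ≠ 0 ∨ occurrences s' t v ≠ 0 := by omega
      · obtain ⟨i, hi, rfl⟩ := occurrences_ne_zero.1 hv
        have := hn (i + 1) (by omega)
        omega
      · obtain ⟨i, hi, rfl⟩ := occurrences_ne_zero.1 hv
        have := hn' (i + 1) (by omega)
        omega
    refine eq_zero_of_reflection (c := r - 1) (K := n + 1 - r) (N := n) ?_ ?_ ?_
    · intro v
      have h1 := hsum fun w => if (w : ℤ) = (r - 1) * (v - 1) then 1 else 0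
      rw [hs.sum_indicator_deficits hr,
        hs'.sum_indicator_deficits hr] at h1
      linarith
    · intro v hv
      have := hsupp v hv
      omega
    -- For `r = 2` the factor is `c = 1`, and the bound `2 * v ≤ n = K + 1` is needed.
    · obtain hr | hr := hr.eq_or_lt
      · right
        refine ⟨by omega, fun v hv => ?_⟩
        have := hsupp v hv
        omega
      · left
        omega
  have hrange : ∀ s₁ s₂ : ℕ → ℕ, (∀ v, occurrences s₁ t v - occurrences s₂ t v = 0) →
      Set.range (fun i : Fin t => s₁ (i + 1)) ⊆ Set.range (fun i : Fin t => s₂ (i + 1)) := by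
    rintro s₁ s₂ h _ ⟨i, rfl⟩
    have h1 := h (s₁ (i + 1))
    have h2 : occurrences s₁ t (s₁ (i + 1)) ≠ 0 := occurrences_ne_zero.2 ⟨i, i.2, rfl⟩
    obtain ⟨j, hj, hj'⟩ := occurrences_ne_zero.1 (show occurrences s₂ t (s₁ (i + 1)) ≠ 0 by omega)
    exact ⟨⟨j, hj⟩, by exact_mod_cast hj'⟩
  have hmono : ∀ {s : ℕ → ℕ}, IsBreakSequence n r (t + 1) s →
      StrictMono fun i : Fin t => s (i + 1) := fun hs i j hij => by
    rw [Fin.lt_def] at hij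
    exact hs.lt (by omega) (by omega)
  -- Strictly increasing sequences are determined by their sets of values.
  have heq := ((hmono hs).range_inj (hmono hs')).1 ((hrange s s' hocc).antisymm
    (hrange s' s fun v => by have := hocc v; omega))
  intro i hi
  obtain _ | i := i
  · rw [hs.zero, hs'.zero]
  · exact congrFun heq ⟨i, by omega⟩

end IsBreakSequence

end BreakSequenceRecovery

/-! ### Duality as reflection of the cube -/

section Duality

variable {α : Type*}

/-- The reflection of the unit cube in its centre. -/
def cubeReflection (α : Type*) (x : α → ℝ) : α → ℝ := 1 - x

theorem cubeReflection_involutive : Function.Involutive (cubeReflection α) := fun x => by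
  simp [cubeReflection]

theorem cubeReflection_incidence (B : Set α) : cubeReflection α (incidence B) = incidence Bᶜ := by
  ext i
  by_cases h : i ∈ B <;> simp [cubeReflection, incidence, h]

theorem image_cubeReflection_convexHull (V : Set (α → ℝ)) :
    cubeReflection α '' convexHull ℝ V = convexHull ℝ (cubeReflection α '' V) :=
  (AffineMap.const ℝ (α → ℝ) (1 : α → ℝ) - AffineMap.id ℝ (α → ℝ)).image_convexHull V

theorem basePolytope_dual {M : Matroid α} (hM : M.E = Set.univ) :
    basePolytope M✶ = cubeReflection α '' basePolytope M := by
  rw [basePolytope, basePolytope, image_cubeReflection_convexHull]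
  congr 1
  ext x
  constructor
  · rintro ⟨B, hB, rfl⟩
    rw [Matroid.dual_isBase_iff (by rw [hM]; exact Set.subset_univ B), hM,
      ← Set.compl_eq_univ_sdiff] at hB
    refine ⟨incidence Bᶜ, ⟨Bᶜ, hB, rfl⟩, ?_⟩
    rw [cubeReflection_incidence, compl_compl]
    rfl
  · rintro ⟨_, ⟨B, hB, rfl⟩, rfl⟩
    refine ⟨Bᶜ, ?_, cubeReflection_incidence B⟩
    rw [Matroid.dual_isBase_iff (by rw [hM]; exact Set.subset_univ _), hM,
      ← Set.compl_eq_univ_sdiff, compl_compl]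
    exact hB

theorem isExposed_image_cubeReflection {P F : Set (α → ℝ)} (h : IsExposed ℝ P F) :
    IsExposed ℝ (cubeReflection α '' P) (cubeReflection α '' F) := by
  intro hne
  obtain ⟨l, rfl⟩ := h hne.of_image
  refine ⟨-l, ?_⟩
  ext x
  constructor
  · rintro ⟨x, ⟨hx, hmax⟩, rfl⟩
    refine ⟨⟨x, hx, rfl⟩, ?_⟩
    rintro _ ⟨y, hy, rfl⟩
    have := hmax y hy
    simp only [cubeReflection, neg_apply, map_sub]
    linarith
  · rintro ⟨⟨x, hx, rfl⟩, hmax⟩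
    refine ⟨x, ⟨hx, fun y hy => ?_⟩, rfl⟩
    have := hmax _ ⟨y, hy, rfl⟩
    simp only [cubeReflection, neg_apply, map_sub] at this
    linarith

/-- Reflecting a polytope does not change its face lattice. -/
def faceLatticeReflection (P : Set (α → ℝ)) :
    FaceLattice P ≃o FaceLattice (cubeReflection α '' P) where
  toFun F := ⟨cubeReflection α '' F.1, isExposed_image_cubeReflection F.2⟩
  invFun F := ⟨cubeReflection α '' F.1, by
    have := isExposed_image_cubeReflection F.2
    rwa [Set.image_image, Set.image_congr fun x _ => cubeReflection_involutive x, Set.image_id']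
      at this⟩
  left_inv F := by
    ext1
    simp [Set.image_image, cubeReflection_involutive _]
  right_inv F := by
    ext1
    simp [Set.image_image, cubeReflection_involutive _]
  map_rel_iff' := by
    intro F G
    exact Set.image_subset_image_iff cubeReflection_involutive.injective

theorem combEquiv_dual {M : Matroid α} (hM : M.E = Set.univ) :
    CombEquiv (basePolytope M) (basePolytope M✶) := by
  rw [basePolytope_dual hM]
  exact ⟨faceLatticeReflection _⟩

theorem CombEquiv.symm {P Q : Set (α → ℝ)} (h : CombEquiv P Q) : CombEquiv Q P :=
  h.map OrderIso.symm

theorem CombEquiv.trans {P Q R : Set (α → ℝ)} (h : CombEquiv P Q) (h' : CombEquiv Q R) :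
    CombEquiv P R := by
  obtain ⟨e⟩ := h
  obtain ⟨f⟩ := h'
  exact ⟨e.trans f⟩

theorem IsDecomposition.dual {M : Matroid α} {t : ℕ} {N : Fin t → Matroid α}
    (h : IsDecomposition M N) (hM : M.E = Set.univ) :
    IsDecomposition M✶ fun i => (N i)✶ := by
  have hN : ∀ i, (N i).E = Set.univ := fun i => (h.ground_eq i).trans hM
  have hinj := (cubeReflection_involutive (α := α)).injective
  refine ⟨fun i => h.ground_eq i, ?_, fun i j hij => ?_, fun i j hij => ?_, fun i j hij hsub => ?_⟩
  · simp only [basePolytope_dual hM, basePolytope_dual (hN _), h.eq_iUnion, Set.image_iUnion]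
  · simp only [basePolytope_dual (hN _), ← Set.image_inter hinj]
    exact isExposed_image_cubeReflection (h.face_left i j hij)
  · simp only [basePolytope_dual (hN _), ← Set.image_inter hinj]
    exact isExposed_image_cubeReflection (h.face_right i j hij)
  · simp only [basePolytope_dual (hN _), Set.image_subset_image_iff hinj] at hsub
    exact h.not_subset i j hij hsub

/-- Finiteness keeps `Nat.card` from defaulting to `0`, so injections bound `numDecompositions` from
below. -/
instance finite_matroid [Finite α] : Finite (Matroid α) := by
  refine Finite.of_injective (fun M : Matroid α => (M.E, M.IsBase)) fun M N h => ?_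
  rw [Prod.mk.injEq] at h
  exact Matroid.ext_isBase h.1 fun B _ => by rw [h.2]

theorem numDecompositions_le_dual [Finite α] (t : ℕ) {M : Matroid α} (hM : M.E = Set.univ) :
    numDecompositions t M ≤ numDecompositions t M✶ := by
  refine Nat.card_le_card_of_injective (Quotient.map
    (fun N : Decomposition M t => (⟨_, N.2.dual hM⟩ : Decomposition M✶ t)) ?_) ?_
  · rintro ⟨N, hN⟩ ⟨N', hN'⟩ ⟨σ, h⟩
    refine ⟨σ, fun i => ?_⟩
    exact (combEquiv_dual ((hN.ground_eq i).trans hM)).symm.trans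
      ((h i).trans (combEquiv_dual ((hN'.ground_eq (σ i)).trans hM)))
  · rintro ⟨N, hN⟩ ⟨N', hN'⟩ h
    obtain ⟨σ, h⟩ := Quotient.exact h
    refine Quotient.sound ⟨σ, fun i => ?_⟩
    exact (combEquiv_dual ((hN.ground_eq i).trans hM)).trans
      ((h i).trans (combEquiv_dual ((hN'.ground_eq (σ i)).trans hM)).symm)

theorem uniformMatroid_dual {n r : ℕ} (h : r ≤ n) :
    (uniformMatroid n r)✶ = uniformMatroid n (n - r) := by
  refine Matroid.ext_isBase rfl fun B hB => ?_
  rw [Matroid.dual_isBase_iff, uniformMatroid_ground, ← Set.compl_eq_univ_sdiff,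
    uniformMatroid_isBase_iff h, uniformMatroid_isBase_iff (Nat.sub_le n r)]
  have := Set.ncard_add_ncard_compl B
  rw [Nat.card_eq_fintype_card, Fintype.card_fin] at this
  omega

end Duality

/-! ### From partitions to break sequences -/

section Partitions

/-- The `i` earlier entries contribute at least `2 * i`, and entries `i` and `i + 1` at least twice
the former. -/
theorem two_mul_getD_add_le_sum {l : List ℕ} (hl : l.Pairwise (· ≤ ·)) (h2 : ∀ a ∈ l, 2 ≤ a) {i : ℕ}
    (hi : i + 1 < l.length) : 2 * (l.getD i 0 + i) ≤ l.sum := by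
  induction l generalizing i with
  | nil => simp at hi
  | cons a l ih =>
    rw [List.pairwise_cons] at hl
    obtain _ | i := i
    · obtain _ | ⟨b, l⟩ := l
      · simp at hi
      · have := hl.1 b (by simp)
        simp only [List.getD_cons_zero, List.sum_cons]
        omega
    · have h := ih hl.2 (fun b hb => h2 b (by simp [hb])) (i := i) (by simpa using hi)
      have := h2 a (by simp)
      simp only [List.getD_cons_succ, List.sum_cons]
      omega

/-- The last entry, which `breaks` does not use, is fixed by the sum. -/
theorem eq_of_getD_eq_of_sum_eq {l l' : List ℕ} (hlen : l.length = l'.length)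
    (hsum : l.sum = l'.sum) (h : ∀ i, i + 1 < l.length → l.getD i 0 = l'.getD i 0) : l = l' := by
  induction l generalizing l' with
  | nil => exact (List.length_eq_zero_iff.1 hlen.symm).symm
  | cons a l ih =>
    obtain _ | ⟨a', l'⟩ := l'
    · simp at hlen
    · have haa : a = a' := by
        obtain _ | ⟨b, l⟩ := l
        · rw [List.length_eq_zero_iff.1 (show l'.length = 0 by simpa using hlen.symm)] at hsum
          simpa using hsum
        · simpa using h 0 (by simp)
      subst haa
      rw [ih (by simpa using hlen) (by simpa using hsum) fun i hi => by
        simpa using h (i + 1) (by simpa using hi)]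

/-- The break sequence given by an increasing list of `t` numbers. -/
def breaks (n r t : ℕ) (l : List ℕ) : ℕ → ℕ
  | 0 => 1
  | i + 1 => if i + 1 = t then n + 1 - r else l.getD i 0 + i

variable {n r : ℕ} {l : List ℕ}

theorem two_mul_breaks_le (hl : l.Pairwise (· ≤ ·)) (h2 : ∀ a ∈ l, 2 ≤ a) (hr : 1 ≤ r)
    (hrn : 2 * r ≤ l.sum) {i : ℕ} (hi : i < l.length) :
    2 * breaks l.sum r l.length l i ≤ l.sum := by
  obtain _ | i := i
  · rw [breaks]
    omega
  · rw [breaks, if_neg hi.ne]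
    exact two_mul_getD_add_le_sum hl h2 hi

/-- Adding the index makes the weakly increasing list strictly increasing. The last step is strict
since inner breaks are at most `n / 2` and `n + 1 - r > n / 2`. -/
theorem isBreakSequence_breaks (hl : l.Pairwise (· ≤ ·)) (h2 : ∀ a ∈ l, 2 ≤ a) (hr : 1 ≤ r)
    (hrn : 2 * r ≤ l.sum) (ht : 1 ≤ l.length) :
    IsBreakSequence l.sum r l.length (breaks l.sum r l.length l) where
  zero := rfl
  last := by
    obtain ⟨t, ht⟩ := Nat.exists_eq_add_of_le' ht
    rw [ht, breaks, if_pos rfl]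
    omega
  lt_succ i hi := by
    have h := two_mul_breaks_le hl h2 hr hrn hi
    rw [breaks.eq_2]
    split_ifs with hit
    · omega
    · obtain _ | i := i
      · have := h2 l[0] (List.getElem_mem hi)
        rw [breaks, List.getD_eq_getElem _ _ hi]
        omega
      · have := List.pairwise_iff_getElem.1 hl i (i + 1) (by omega) hi (by omega)
        rw [breaks, if_neg hi.ne, List.getD_eq_getElem _ _ hi, List.getD_eq_getElem _ _ (by omega)]
        omega

theorem eq_of_breaks_eq {l' : List ℕ} (hlen : l.length = l'.length) (hsum : l.sum = l'.sum)
    (h : ∀ i < l.length, breaks l.sum r l.length l i = breaks l'.sum r l'.length l' i) : l = l' := by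
  refine eq_of_getD_eq_of_sum_eq hlen hsum fun i hi => ?_
  have := h (i + 1) hi
  rw [breaks, breaks, if_neg hi.ne, if_neg (hlen ▸ hi.ne)] at this
  omega

theorem exists_isBreakSequence (t : ℕ) (hr : 1 ≤ r) (hrn : 2 * r ≤ n) (ht : 1 ≤ t) :
    ∃ b : n.Partition → ℕ → ℕ,
      (∀ p, (p.parts.card = t ∧ ∀ i ∈ p.parts, 2 ≤ i) →
        IsBreakSequence n r t (b p) ∧ ∀ i < t, 2 * b p i ≤ n) ∧
      ∀ p p', p.parts.card = t → p'.parts.card = t → (∀ i < t, b p i = b p' i) → p = p' := by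
  have hsum : ∀ p : n.Partition, (p.parts.sort (· ≤ ·)).sum = n := fun p => by
    rw [← Multiset.sum_coe, Multiset.sort_eq, p.parts_sum]
  have hlen : ∀ p : n.Partition, p.parts.card = t → (p.parts.sort (· ≤ ·)).length = t :=
    fun p hp => by rw [Multiset.length_sort, hp]
  refine ⟨fun p => breaks n r t (p.parts.sort (· ≤ ·)), ?_, ?_⟩
  · rintro p ⟨hp, hp2⟩
    have hl := Multiset.pairwise_sort p.parts (· ≤ ·)
    have h2 : ∀ a ∈ p.parts.sort (· ≤ ·), 2 ≤ a := fun a ha => hp2 a ((Multiset.mem_sort _).1 ha)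
    have h1 := isBreakSequence_breaks hl h2 hr (by rwa [hsum]) (by rwa [hlen p hp])
    have h3 := fun i => two_mul_breaks_le hl h2 hr (by rwa [hsum]) (i := i)
    simp only [hsum, hlen p hp] at h1 h3
    exact ⟨h1, h3⟩
  · intro p p' hp hp' h
    have := eq_of_breaks_eq (r := r) ((hlen p hp).trans (hlen p' hp').symm)
      ((hsum p).trans (hsum p').symm) (by simpa only [hsum, hlen p hp, hlen p' hp'] using h)
    refine Nat.Partition.ext ?_
    rw [← Multiset.sort_eq p.parts (· ≤ ·), this, Multiset.sort_eq]

theorem numParts_le_numDecompositions_of_two_mul_le (t : ℕ) (hr : 2 ≤ r) (hrn : 2 * r ≤ n)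
    (ht : 1 ≤ t) : numParts t n ≤ numDecompositions t (uniformMatroid n r) := by
  obtain ⟨b, hb, hinj⟩ := exists_isBreakSequence t (one_le_two.trans hr) hrn ht
  rw [numParts, ← Fintype.card_coe, ← Nat.card_eq_fintype_card]
  have hmem : ∀ p : {p // p ∈ Finset.univ.filter fun p : n.Partition =>
      p.parts.card = t ∧ ∀ i ∈ p.parts, 2 ≤ i}, _ := fun p => (Finset.mem_filter.1 p.2).2
  refine Nat.card_le_card_of_injective (fun p => Quotient.mk (decompositionSetoid _ t)
    ⟨_, (hb p.1 (hmem p)).1.isDecomposition hr ht⟩) fun p p' h => ?_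
  obtain ⟨σ, h⟩ := Quotient.exact h
  exact Subtype.ext (hinj p.1 p'.1 (hmem p).1 (hmem p').1
    ((hb p.1 (hmem p)).1.eq_of_combEquiv (hb p'.1 (hmem p')).1 hr (hb p.1 (hmem p)).2
      (hb p'.1 (hmem p')).2 σ h))

end Partitions

end MatroidDecomposition

theorem corollary1 (n r t : ℕ) (hn : 2 ≤ n) (hr : 2 ≤ r) (ht : 2 ≤ t)
    (hnrt : r + t ≤ n) (hrt : t ≤ r) :
    numParts t n ≤ MatroidDecomposition.numDecompositions t (uniformMatroid n r) := by
  obtain h | h := le_total (2 * r) n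
  · exact MatroidDecomposition.numParts_le_numDecompositions_of_two_mul_le t hr h (by omega)
  -- The dual rank satisfies `n - r ≥ t ≥ 2` and `2 * (n - r) ≤ n`.
  · have h1 := MatroidDecomposition.numParts_le_numDecompositions_of_two_mul_le (n := n)
      (r := n - r) t (by omega) (by omega) (by omega)
    have h2 := MatroidDecomposition.numDecompositions_le_dual t
      (MatroidDecomposition.uniformMatroid_ground (n := n) (r := n - r))
    rw [MatroidDecomposition.uniformMatroid_dual (Nat.sub_le n r), Nat.sub_sub_self (by omega)]
      at h2
    exact h1.trans h2
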